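/- **Conventions.** A *doctrine* is a functor $P:\mathcal C^{op}\to\mathbf{PreOrd}$ on an arbitrary base category (with fibres in a universe containing the objects and arrows of $\mathcal C$). Its total category $\mathcal C\rtimes P$ has objects $(c,x)$ with $x\in P(c)$, and arrows $(c,x)\to(d,y)$ the arrows $f:c\to d$ of $\mathcal C$ with $x\le P(f)(y)$. A *doctrinal site* $(P,J)$ is a doctrine with a Grothendieck topology $J$ on $\mathcal C\rtimes P$. In the 2-category $\mathbf{DocSites}$, a 1-cell $(P,J)\to(Q,K)$ is a pair $(F,a)$ of a functor $F:\mathcal C\to\mathcal D$ that is flat (a morphism of sites for the trivial topologies) and a natural transformation $a:P\to Q\circ F^{op}$ such that $F\rtimes a:(\mathcal C\rtimes P,J)\to(\mathcal D\rtimes Q,K)$ is a morphism of sites; a 2-cell $(F,a)\to(F',a')$ is a natural transformation $\alpha:F\to F'$ with $a_c(x)\le Q(\alpha_c)(a'_c(x))$ for all $c\in\mathcal C$, $x\in P(c)$. A *geometric doctrine* is a functor $\mathbb L:\mathcal C^{op}\to\mathbf{Frm}$ whose transition maps $\mathbb L(f)$ have left adjoints $\exists_f$ satisfying the Frobenius condition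 and which satisfies the relative Beck–Chevalley condition: if $S$ is a sieve on $(d,V)$ in $\mathcal C\rtimes\mathbb L$ with $V=\bigvee_{(f:(c,U)\to(d,V))\in S}\exists_f U$, then for each $h:e\to d$, $\mathbb L(h)(V)=\bigvee_{(g:(c,W)\to(e,\mathbb L(h)(V)))\in h^*S}\exists_g W$. It carries the topology $K_{\mathbb L}$ on $\mathcal C\rtimes\mathbb L$, for which $S$ covers $(d,V)$ iff $V=\bigvee_{f\in S}\exists_fU$. $\mathbf{GeomDoc}$ is the full sub-2-category of $\mathbf{DocSites}$ on the sites $(\mathbb L,K_{\mathbb L})$. The *geometric completion* of $(P,J)$ is the geometric doctrine $\mathfrak Z(P,J)$ over $\mathcal C$ whose fibre over $c$ is the frame, ordered by inclusion, of those sets $S$ of pairs $(f:d\to c,\;x\in P(d))$ such that (a) if $(f,x)\in S$, $g:e\to d$ and $y\le P(g)(x)$, then $(fg,y)\in S$; (b) $(f,x)\in S$ whenever there is a $J$-covering family $\{h_i:(e_i,y_i)\to(d,x)\}_{i\in I}$ with all $(fh_i,y_i)\in S$. Its transition maps are $f^*S=\{(g,y)\mid(fg,y)\in S\}$. The unit $\eta^{(P,J)}:P\to\mathfrak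 Z(P,J)$ sends $x\in P(c)$ to the smallest element of $\mathfrak Z(P,J)(c)$ containing $\{(g,y)\mid y\le P(g)(x)\}$. A *coarse geometric completion* consists of a 2-subcategory $A\text{-}\mathbf{Doc}\subseteq\mathbf{DocSites}$ full on 2-cells, a 2-subcategory $\mathbf{GeomDoc}_A\subseteq\mathbf{GeomDoc}$ full on 1-cells and 2-cells, and, for each $\mathbb L\in\mathbf{GeomDoc}_A$, a Grothendieck topology $J^A_{\mathbb L}\subseteq K_{\mathbb L}$ on $\mathcal C\rtimes\mathbb L$ with $(\mathbb L,J^A_{\mathbb L})\in A\text{-}\mathbf{Doc}$, such that 1. every morphism of geometric doctrines $(F,a):\mathbb L\to\mathbb L'$ between objects of $\mathbf{GeomDoc}_A$ is also a 1-cell $(F,a):(\mathbb L,J^A_{\mathbb L})\to(\mathbb L',J^A_{\mathbb L'})$ of $A\text{-}\mathbf{Doc}$, so that there is a 2-embedding $\iota:\mathbf{GeomDoc}_A\hookrightarrow A\text{-}\mathbf{Doc}$, $\mathbb L\mapsto(\mathbb L,J^A_{\mathbb L})$; 2. for each $(P,J)\in A\text{-}\mathbf{Doc}$, $\mathfrak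 Z(P,J)$ lies in $\mathbf{GeomDoc}_A$ and $(\mathrm{id}_{\mathcal C},\eta^{(P,J)}):(P,J)\to(\mathfrak Z(P,J),J^A_{\mathfrak Z(P,J)})$ is a 1-cell of $A\text{-}\mathbf{Doc}$. A strict 2-monad $(T,\eta,\mu)$ is *lax-idempotent* if there are 2-cells $\lambda_X:T\eta_X\Rightarrow\eta_{TX}$, natural in $X$, such that the whiskered 2-cells $\lambda_X\eta_X$ and $\mu_X\lambda_X$ are identity 2-cells. **Corollary 6.5.** For every coarse geometric completion, there is a strict 2-functor $\mathfrak Z_A:A\text{-}\mathbf{Doc}\to\mathbf{GeomDoc}_A$, given on objects by $(P,J)\mapsto\mathfrak Z(P,J)$, which is strictly left 2-adjoint to $\iota$ with unit components $(\mathrm{id}_{\mathcal C},\eta^{(P,J)})$, and the induced strict 2-monad $\iota\mathfrak Z_A$ on $A\text{-}\mathbf{Doc}$ is lax-idempotent. -/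

import Mathlib

set_option linter.checkUnivs false

open CategoryTheory Opposite

universe v u w v₁ v₂ v₃ u₁ u₂ u₃ w₁ w₂

namespace CoarseGeom

/-! ### Morphisms of sites -/

/-- A morphism of sites `(C, J) ⟶ (D, K)`. The existence of a covering family with a given
(precomposition-stable) property is expressed by the existence of a covering sieve. -/
structure IsMorphismOfSites {C : Type u₁} [Category.{v₁} C] {D : Type u₂} [Category.{v₂} D]
    (J : GrothendieckTopology C) (K : GrothendieckTopology D) (F : C ⥤ D) : Prop where
  /-- Covering sieves are sent to families generating covering sieves. -/
  cover_preserving : ∀ {c : C} (S : Sieve c), S ∈ J c → S.functorPushforward F ∈ K (F.obj c)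
  /-- Every object of `D` is covered by objects mapping to the image of `F`. -/
  cover_obj : ∀ d : D, ∃ S ∈ K d, ∀ ⦃d' : D⦄ (h : d' ⟶ d), S h → ∃ c : C, Nonempty (d' ⟶ F.obj c)
  /-- Locally, any span to the image of `F` factors through the image of a span. -/
  cover_span : ∀ {c₁ c₂ : C} {d : D} (g₁ : d ⟶ F.obj c₁) (g₂ : d ⟶ F.obj c₂),
    ∃ S ∈ K d, ∀ ⦃d' : D⦄ (h : d' ⟶ d), S h →
      ∃ (c : C) (f₁ : c ⟶ c₁) (f₂ : c ⟶ c₂) (k : d' ⟶ F.obj c),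
        k ≫ F.map f₁ = h ≫ g₁ ∧ k ≫ F.map f₂ = h ≫ g₂
  /-- Locally, any arrow equalizing `F f₁` and `F f₂` factors through the image of an arrow
  equalizing `f₁` and `f₂`. -/
  cover_equalizer : ∀ {c' c : C} (f₁ f₂ : c' ⟶ c) {d : D} (g : d ⟶ F.obj c'),
    g ≫ F.map f₁ = g ≫ F.map f₂ →
    ∃ S ∈ K d, ∀ ⦃d' : D⦄ (h : d' ⟶ d), S h →
      ∃ (b : C) (e : b ⟶ c') (k : d' ⟶ F.obj b),
        e ≫ f₁ = e ≫ f₂ ∧ k ≫ F.map e = h ≫ g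

/-- A functor is flat if it is a morphism of sites for the trivial topologies. -/
def IsFlat {C : Type u₁} [Category.{v₁} C] {D : Type u₂} [Category.{v₂} D] (F : C ⥤ D) : Prop :=
  IsMorphismOfSites (GrothendieckTopology.trivial C) (GrothendieckTopology.trivial D) F

theorem IsMorphismOfSites.id {C : Type u₁} [Category.{v₁} C] (J : GrothendieckTopology C) :
    IsMorphismOfSites J J (𝟭 C) where
  cover_preserving S hS := by simpa using hS
  cover_obj d := ⟨⊤, J.top_mem d, fun d' _ _ => ⟨d', ⟨𝟙 d'⟩⟩⟩
  cover_span {c₁ c₂ d} g₁ g₂ := ⟨⊤, J.top_mem d, fun d' h _ =>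
    ⟨d', h ≫ g₁, h ≫ g₂, 𝟙 d', by simp, by simp⟩⟩
  cover_equalizer f₁ f₂ d g hg := ⟨⊤, J.top_mem d, fun d' h _ =>
    ⟨d', h ≫ g, 𝟙 d', by simpa using congrArg (h ≫ ·) hg, by simp⟩⟩

theorem IsMorphismOfSites.comp {C : Type u₁} [Category.{v₁} C] {D : Type u₂} [Category.{v₂} D]
    {E : Type u₃} [Category.{v₃} E] {J : GrothendieckTopology C} {K : GrothendieckTopology D}
    {M : GrothendieckTopology E} {F : C ⥤ D} {G : D ⥤ E}
    (hF : IsMorphismOfSites J K F) (hG : IsMorphismOfSites K M G) :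
    IsMorphismOfSites J M (F ⋙ G) := by
  have key : ∀ {e : E} {d : D} (k : e ⟶ G.obj d) (R : Sieve d), R ∈ K d →
      ∃ T ∈ M e, ∀ ⦃e' : E⦄ (l : e' ⟶ e), T l →
        ∃ (d' : D) (r : d' ⟶ d) (m : e' ⟶ G.obj d'), R r ∧ m ≫ G.map r = l ≫ k := by
    intro e d k R hR
    refine ⟨(R.functorPushforward G).pullback k,
      M.pullback_stable k (hG.cover_preserving R hR), ?_⟩
    rintro e' l ⟨d', r, m, hr, hm⟩
    exact ⟨d', r, m, hr, hm.symm⟩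
  refine ⟨?_, ?_, ?_, ?_⟩
  · intro c S hS
    rw [Sieve.functorPushforward_comp]
    exact hG.cover_preserving _ (hF.cover_preserving _ hS)
  · intro e
    obtain ⟨S, hS, h⟩ := hG.cover_obj e
    refine ⟨Sieve.bind S fun {e'} l hl => (key (h l hl).choose_spec.some _
      (hF.cover_obj (h l hl).choose).choose_spec.1).choose, ?_, ?_⟩
    · apply M.bind_covering hS
      intro e' l hl
      exact (key (h l hl).choose_spec.some _
        (hF.cover_obj (h l hl).choose).choose_spec.1).choose_spec.1
    · rintro e'' _ ⟨e', n, l, hl, hn, rfl⟩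
      obtain ⟨d', r, m, hr, -⟩ := (key (h l hl).choose_spec.some _
        (hF.cover_obj (h l hl).choose).choose_spec.1).choose_spec.2 n hn
      obtain ⟨c, ⟨q⟩⟩ := (hF.cover_obj (h l hl).choose).choose_spec.2 r hr
      exact ⟨c, ⟨m ≫ G.map q⟩⟩
  · intro c₁ c₂ e g₁ g₂
    obtain ⟨S, hS, h⟩ := hG.cover_span g₁ g₂
    have h' : ∀ ⦃e' : E⦄ (l : e' ⟶ e), S l → ∃ T ∈ M e', ∀ ⦃e'' : E⦄ (n : e'' ⟶ e'), T n →
        ∃ (c : C) (f₁ : c ⟶ c₁) (f₂ : c ⟶ c₂) (k : e'' ⟶ (F ⋙ G).obj c),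
          k ≫ (F ⋙ G).map f₁ = (n ≫ l) ≫ g₁ ∧ k ≫ (F ⋙ G).map f₂ = (n ≫ l) ≫ g₂ := by
      intro e' l hl
      obtain ⟨d, p₁, p₂, k, hk₁, hk₂⟩ := h l hl
      obtain ⟨R, hR, hR'⟩ := hF.cover_span p₁ p₂
      obtain ⟨T, hT, hT'⟩ := key k R hR
      refine ⟨T, hT, fun e'' n hn => ?_⟩
      obtain ⟨d', r, m, hr, hm⟩ := hT' n hn
      obtain ⟨c, f₁, f₂, q, hq₁, hq₂⟩ := hR' r hr
      refine ⟨c, f₁, f₂, m ≫ G.map q, ?_, ?_⟩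
      · simp only [Functor.comp_map, Category.assoc, ← G.map_comp, hq₁]
        rw [G.map_comp, ← Category.assoc, hm, Category.assoc, hk₁]
      · simp only [Functor.comp_map, Category.assoc, ← G.map_comp, hq₂]
        rw [G.map_comp, ← Category.assoc, hm, Category.assoc, hk₂]
    choose T hT hT' using h'
    refine ⟨Sieve.bind S fun {e'} l hl => T l hl, M.bind_covering hS fun e' l hl => hT l hl, ?_⟩
    rintro e'' _ ⟨e', n, l, hl, hn, rfl⟩
    exact hT' l hl n hn
  · intro c' c f₁ f₂ e g hg
    obtain ⟨S, hS, h⟩ := hG.cover_equalizer (F.map f₁) (F.map f₂) g hg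
    have h' : ∀ ⦃e' : E⦄ (l : e' ⟶ e), S l → ∃ T ∈ M e', ∀ ⦃e'' : E⦄ (n : e'' ⟶ e'), T n →
        ∃ (b : C) (q : b ⟶ c') (k : e'' ⟶ (F ⋙ G).obj b),
          q ≫ f₁ = q ≫ f₂ ∧ k ≫ (F ⋙ G).map q = (n ≫ l) ≫ g := by
      intro e' l hl
      obtain ⟨d, p, k, hp, hk⟩ := h l hl
      obtain ⟨R, hR, hR'⟩ := hF.cover_equalizer f₁ f₂ p hp
      obtain ⟨T, hT, hT'⟩ := key k R hR
      refine ⟨T, hT, fun e'' n hn => ?_⟩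
      obtain ⟨d', r, m, hr, hm⟩ := hT' n hn
      obtain ⟨b, q, s, hq, hs⟩ := hR' r hr
      refine ⟨b, q, m ≫ G.map s, hq, ?_⟩
      simp only [Functor.comp_map, Category.assoc, ← G.map_comp, hs]
      rw [G.map_comp, ← Category.assoc, hm, Category.assoc, hk]
    choose T hT hT' using h'
    refine ⟨Sieve.bind S fun {e'} l hl => T l hl, M.bind_covering hS fun e' l hl => hT l hl, ?_⟩
    rintro e'' _ ⟨e', n, l, hl, hn, rfl⟩
    exact hT' l hl n hn

/-! ### Doctrines and their total categories -/

/-- A doctrine `P : Cᵒᵖ ⥤ PreOrd` over an arbitrary base category. The universe of the fibres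
is chosen large enough to contain the fibres of the geometric completion. -/
structure Doctrine where
  /-- The base category. -/
  base : Type u
  [cat : Category.{v} base]
  /-- The indexed preorder. -/
  fn : baseᵒᵖ ⥤ Preord.{max u v w}

attribute [instance] Doctrine.cat

namespace Doctrine

/-- The fibre over `c`. -/
abbrev fib (P : Doctrine.{v, u, w}) (c : P.base) : Type (max u v w) := P.fn.obj (op c)

/-- The transition map `P(f) : P(c) → P(d)` for `f : d ⟶ c`. -/
def pull (P : Doctrine.{v, u, w}) {d c : P.base} (f : d ⟶ c) : P.fib c →o P.fib d :=
  (P.fn.map f.op).hom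

@[simp]
theorem pull_id (P : Doctrine.{v, u, w}) {c : P.base} (x : P.fib c) : P.pull (𝟙 c) x = x := by
  simp [pull]

@[simp]
theorem pull_comp (P : Doctrine.{v, u, w}) {e d c : P.base} (g : e ⟶ d) (f : d ⟶ c)
    (x : P.fib c) : P.pull (g ≫ f) x = P.pull g (P.pull f x) := by
  simp [pull]

/-- Objects of the Grothendieck construction `C ⋊ P`. -/
structure Total (P : Doctrine.{v, u, w}) where
  base : P.base
  elt : P.fib base

/-- Arrows of `C ⋊ P`. -/
@[ext]
structure Total.Hom {P : Doctrine.{v, u, w}} (X Y : P.Total) where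
  hom : X.base ⟶ Y.base
  elt_le : X.elt ≤ P.pull hom Y.elt

instance (P : Doctrine.{v, u, w}) : Category P.Total where
  Hom X Y := Total.Hom X Y
  id X := ⟨𝟙 X.base, by simp⟩
  comp f g := ⟨f.hom ≫ g.hom, by
    rw [pull_comp]; exact f.elt_le.trans ((P.pull f.hom).monotone g.elt_le)⟩

@[simp]
theorem Total.id_hom {P : Doctrine.{v, u, w}} (X : P.Total) :
    Total.Hom.hom (𝟙 X) = 𝟙 X.base := rfl

@[simp]
theorem Total.comp_hom {P : Doctrine.{v, u, w}} {X Y Z : P.Total} (f : X ⟶ Y) (g : Y ⟶ Z) :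
    Total.Hom.hom (f ≫ g) = f.hom ≫ g.hom := rfl

@[ext]
theorem Total.hom_ext {P : Doctrine.{v, u, w}} {X Y : P.Total} {f g : X ⟶ Y}
    (h : f.hom = g.hom) : f = g := Total.Hom.ext h

/-- The component `a_c : P(c) → Q(F c)` of a natural transformation `a : P ⟶ Q ∘ Fᵒᵖ`. -/
def comp {P Q : Doctrine.{v, u, w}} {F : P.base ⥤ Q.base} (a : P.fn ⟶ F.op ⋙ Q.fn)
    (c : P.base) : P.fib c →o Q.fib (F.obj c) := (a.app (op c)).hom

theorem comp_pull {P Q : Doctrine.{v, u, w}} {F : P.base ⥤ Q.base} (a : P.fn ⟶ F.op ⋙ Q.fn)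
    {d c : P.base} (f : d ⟶ c) (x : P.fib c) :
    comp a d (P.pull f x) = Q.pull (F.map f) (comp a c x) :=
  ConcreteCategory.congr_hom (a.naturality f.op) x

/-- The functor `F ⋊ a : C ⋊ P ⥤ D ⋊ Q`. -/
def totalMap {P Q : Doctrine.{v, u, w}} (F : P.base ⥤ Q.base) (a : P.fn ⟶ F.op ⋙ Q.fn) :
    P.Total ⥤ Q.Total where
  obj X := ⟨F.obj X.base, comp a X.base X.elt⟩
  map f := ⟨F.map f.hom, by rw [← comp_pull]; exact (comp a _).monotone f.elt_le⟩

end Doctrine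

/-! ### The 2-category of doctrinal sites -/

/-- A doctrinal site: a doctrine `P` with a Grothendieck topology on `C ⋊ P`. -/
structure DocSite extends Doctrine.{v, u, w} where
  /-- The topology on the total category. -/
  top : GrothendieckTopology toDoctrine.Total

namespace DocSite

/-- Morphisms of doctrinal sites. -/
structure Hom (P Q : DocSite.{v, u, w}) where
  /-- The functor between base categories. -/
  F : P.base ⥤ Q.base
  /-- The natural transformation `P ⟶ Q ∘ Fᵒᵖ`. -/
  a : P.fn ⟶ F.op ⋙ Q.fn
  flat : IsFlat F
  site : IsMorphismOfSites P.top Q.top (Doctrine.totalMap F a)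

/-- The 2-cells `(F, a) ⟶ (F', a')`: natural transformations `α : F ⟶ F'` with
`a_c(x) ≤ Q(α_c)(a'_c(x))`. -/
@[ext]
structure Hom₂ {P Q : DocSite.{v, u, w}} (f g : Hom P Q) where
  /-- The underlying natural transformation. -/
  nat : f.F ⟶ g.F
  fib_le : ∀ (c : P.base) (x : P.fib c),
    Doctrine.comp f.a c x ≤ Q.pull (nat.app c) (Doctrine.comp g.a c x)

instance : CategoryStruct DocSite.{v, u, w} where
  Hom P Q := Hom P Q
  id P := ⟨𝟭 P.base, 𝟙 P.fn, IsMorphismOfSites.id _, IsMorphismOfSites.id _⟩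
  comp f g := ⟨f.F ⋙ g.F, f.a ≫ Functor.whiskerLeft f.F.op g.a, f.flat.comp g.flat,
    f.site.comp g.site⟩

@[simp]
theorem id_F (P : DocSite.{v, u, w}) : Hom.F (𝟙 P) = 𝟭 P.base := rfl

@[simp]
theorem comp_F {P Q R : DocSite.{v, u, w}} (f : P ⟶ Q) (g : Q ⟶ R) :
    Hom.F (f ≫ g) = f.F ⋙ g.F := rfl

@[simps]
instance homCategory (P Q : DocSite.{v, u, w}) : Category (P ⟶ Q) where
  Hom f g := Hom₂ f g
  id f := ⟨𝟙 f.F, fun c x => by simp⟩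
  comp {f g h} α β := ⟨α.nat ≫ β.nat, fun c x => by
    rw [NatTrans.comp_app, Doctrine.pull_comp]
    exact (α.fib_le c x).trans ((Q.pull _).monotone (β.fib_le c x))⟩

@[ext]
theorem hom₂_ext {P Q : DocSite.{v, u, w}} {f g : P ⟶ Q} {α β : f ⟶ g}
    (h : α.nat = β.nat) : α = β := Hom₂.ext h

/-- An invertible 2-cell from a natural isomorphism compatible with the fibre maps. -/
def isoMk {P Q : DocSite.{v, u, w}} {f g : P ⟶ Q} (e : f.F ≅ g.F)
    (h₁ : ∀ (c : P.base) (x : P.fib c),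
      Doctrine.comp f.a c x ≤ Q.pull (e.hom.app c) (Doctrine.comp g.a c x))
    (h₂ : ∀ (c : P.base) (x : P.fib c),
      Doctrine.comp g.a c x ≤ Q.pull (e.inv.app c) (Doctrine.comp f.a c x)) : f ≅ g where
  hom := ⟨e.hom, h₁⟩
  inv := ⟨e.inv, h₂⟩
  hom_inv_id := by ext1; exact e.hom_inv_id
  inv_hom_id := by ext1; exact e.inv_hom_id

/-- Precomposition of a 2-cell with a 1-cell. -/
def whiskerLeft {P Q R : DocSite.{v, u, w}} (f : P ⟶ Q) {g h : Q ⟶ R} (η : g ⟶ h) :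
    f ≫ g ⟶ f ≫ h :=
  Hom₂.mk (Functor.whiskerLeft f.F η.nat) fun c x => η.fib_le (f.F.obj c) (Doctrine.comp f.a c x)

/-- Postcomposition of a 2-cell with a 1-cell. -/
def whiskerRight {P Q R : DocSite.{v, u, w}} {f g : P ⟶ Q} (η : f ⟶ g) (h : Q ⟶ R) :
    f ≫ h ⟶ g ≫ h :=
  Hom₂.mk (Functor.whiskerRight η.nat h.F) fun c x => by
    have := (Doctrine.comp h.a (f.F.obj c)).monotone (η.fib_le c x)
    rw [Doctrine.comp_pull] at this
    exact this

instance : Bicategory DocSite.{v, u, w} where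
  homCategory := homCategory
  whiskerLeft f _ _ η := whiskerLeft f η
  whiskerRight η h := whiskerRight η h
  associator {P Q R S} f g h := isoMk (f := (f ≫ g) ≫ h) (g := f ≫ g ≫ h)
    (Functor.associator f.F g.F h.F)
    (fun c x => by exact (S.pull_id _).ge) (fun c x => by exact (S.pull_id _).ge)
  leftUnitor {P Q} f := isoMk (f := 𝟙 P ≫ f) (g := f) (Functor.leftUnitor f.F)
    (fun c x => by exact (Q.pull_id _).ge) (fun c x => by exact (Q.pull_id _).ge)
  rightUnitor {P Q} f := isoMk (f := f ≫ 𝟙 Q) (g := f) (Functor.rightUnitor f.F)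
    (fun c x => by exact (Q.pull_id _).ge) (fun c x => by exact (Q.pull_id _).ge)
  whiskerLeft_id _ _ := hom₂_ext (by ext; simp [whiskerLeft])
  whiskerLeft_comp _ _ _ _ _ _ := hom₂_ext (by ext; simp [whiskerLeft])
  id_whiskerLeft η := hom₂_ext (by ext; simp [whiskerLeft, isoMk])
  comp_whiskerLeft f g _ _ η := hom₂_ext (by ext; simp [whiskerLeft, isoMk])
  id_whiskerRight _ _ := hom₂_ext (by ext; simp [whiskerRight])
  comp_whiskerRight _ _ _ := hom₂_ext (by ext; simp [whiskerRight])
  whiskerRight_id η := hom₂_ext (by ext; simp [whiskerRight, isoMk])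
  whiskerRight_comp η f g := hom₂_ext (by ext; simp [whiskerRight, isoMk])
  whisker_assoc f _ _ η g := hom₂_ext (by ext; simp [whiskerLeft, whiskerRight, isoMk])
  whisker_exchange η θ := hom₂_ext (by ext; simp [whiskerLeft, whiskerRight])
  pentagon f g h i := hom₂_ext (by ext; simp [whiskerLeft, whiskerRight, isoMk])
  triangle f g := hom₂_ext (by ext; simp [whiskerLeft, whiskerRight, isoMk])

theorem eqToHom_nat {P Q : DocSite.{v, u, w}} {f g : P ⟶ Q} (h : f = g) :
    Hom₂.nat (eqToHom h) = eqToHom (congrArg Hom.F h) := by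
  subst h; rfl

instance : Bicategory.Strict DocSite.{v, u, w} where
  id_comp _ := rfl
  comp_id _ := rfl
  assoc _ _ _ := rfl
  leftUnitor_eqToIso _ := rfl
  rightUnitor_eqToIso _ := rfl
  associator_eqToIso _ _ _ := rfl

end DocSite
/-! ### Geometric doctrines -/

/-- An open frame homomorphism: one with a left adjoint satisfying the Frobenius condition. -/
def IsOpenFrameHom {A B : Type*} [Order.Frame A] [Order.Frame B] (g : FrameHom A B) : Prop :=
  ∃ e : B → A, GaloisConnection e g ∧ ∀ (b : B) (a : A), e (b ⊓ g a) = e b ⊓ a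

/-- A doctrine valued in frames and open frame homomorphisms. -/
structure FrmOpenDoctrine where
  /-- The base category. -/
  base : Type u
  [cat : Category.{v} base]
  /-- The indexed frame. -/
  fn : baseᵒᵖ ⥤ Frm.{max u v w}
  isOpen : ∀ {d c : base} (f : d ⟶ c), IsOpenFrameHom (fn.map f.op).hom

attribute [instance] FrmOpenDoctrine.cat

namespace FrmOpenDoctrine

/-- The fibre over `c`. -/
abbrev fib (L : FrmOpenDoctrine.{v, u, w}) (c : L.base) : Type (max u v w) := L.fn.obj (op c)

/-- The transition frame homomorphism. -/
def pull (L : FrmOpenDoctrine.{v, u, w}) {d c : L.base} (f : d ⟶ c) :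
    FrameHom (L.fib c) (L.fib d) := (L.fn.map f.op).hom

@[simp]
theorem pull_id (L : FrmOpenDoctrine.{v, u, w}) {c : L.base} (x : L.fib c) :
    L.pull (𝟙 c) x = x := by
  simp [pull]

@[simp]
theorem pull_comp (L : FrmOpenDoctrine.{v, u, w}) {e d c : L.base} (g : e ⟶ d) (f : d ⟶ c)
    (x : L.fib c) : L.pull (g ≫ f) x = L.pull g (L.pull f x) := by
  simp [pull]

/-- The left adjoint `∃_f` of `L(f)`. -/
noncomputable def ex (L : FrmOpenDoctrine.{v, u, w}) {d c : L.base} (f : d ⟶ c) :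
    L.fib d → L.fib c := (L.isOpen f).choose

theorem ex_gc (L : FrmOpenDoctrine.{v, u, w}) {d c : L.base} (f : d ⟶ c) :
    GaloisConnection (L.ex f) (L.pull f) := (L.isOpen f).choose_spec.1

theorem ex_frobenius (L : FrmOpenDoctrine.{v, u, w}) {d c : L.base} (f : d ⟶ c)
    (U : L.fib d) (V : L.fib c) : L.ex f (U ⊓ L.pull f V) = L.ex f U ⊓ V :=
  (L.isOpen f).choose_spec.2 U V

/-- The underlying doctrine, forgetting the frame structure of the fibres. -/
def toDoctrine (L : FrmOpenDoctrine.{v, u, w}) : Doctrine.{v, u, w} where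
  base := L.base
  fn :=
    { obj := fun c => Preord.of (L.fn.obj c)
      map := fun f => Preord.ofHom ((L.fn.map f).hom : _ →o _)
      map_id := fun c => by ext x; simp
      map_comp := fun f g => by ext x; simp }

/-- The total category `C ⋊ L`. -/
abbrev Total (L : FrmOpenDoctrine.{v, u, w}) := L.toDoctrine.Total

/-- The base object of an object of `C ⋊ L`. -/
abbrev pt (L : FrmOpenDoctrine.{v, u, w}) (X : L.Total) : L.base := Doctrine.Total.base X

/-- The fibre element of an object of `C ⋊ L`. -/
abbrev val (L : FrmOpenDoctrine.{v, u, w}) (X : L.Total) : L.fib (L.pt X) := Doctrine.Total.elt X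

/-- The base arrow of an arrow of `C ⋊ L`. -/
abbrev arr (L : FrmOpenDoctrine.{v, u, w}) {X Y : L.Total} (f : X ⟶ Y) : L.pt X ⟶ L.pt Y :=
  Doctrine.Total.Hom.hom f

/-- The object `(c, U)` of `C ⋊ L`. -/
abbrev mkObj (L : FrmOpenDoctrine.{v, u, w}) (c : L.base) (U : L.fib c) : L.Total :=
  Doctrine.Total.mk (P := L.toDoctrine) c U

/-- The arrow `(d, U) ⟶ (c, V)` of `C ⋊ L` given by `f : d ⟶ c` with `U ≤ L(f)(V)`. -/
abbrev mkHom (L : FrmOpenDoctrine.{v, u, w}) {d c : L.base} {U : L.fib d} {V : L.fib c}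
    (f : d ⟶ c) (h : U ≤ L.pull f V) : L.mkObj d U ⟶ L.mkObj c V :=
  Doctrine.Total.Hom.mk (P := L.toDoctrine) f h

theorem val_le (L : FrmOpenDoctrine.{v, u, w}) {X Y : L.Total} (f : X ⟶ Y) :
    L.val X ≤ L.pull (L.arr f) (L.val Y) := Doctrine.Total.Hom.elt_le f

/-- The join `⋁_{f ∈ S} ∃_f U`, over all arrows `f : (c, U) ⟶ Y` in a sieve `S`. -/
noncomputable def sieveSup (L : FrmOpenDoctrine.{v, u, w}) {Y : L.Total} (S : Sieve Y) :
    L.fib (L.pt Y) :=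
  ⨆ (X : L.Total) (f : X ⟶ Y) (_ : S f), L.ex (L.arr f) (L.val X)

/-- The cartesian arrow `(e, L(h)(V)) ⟶ (d, V)` over `h : e ⟶ d`. -/
def cartesian (L : FrmOpenDoctrine.{v, u, w}) {e d : L.base} (h : e ⟶ d) (V : L.fib d) :
    L.mkObj e (L.pull h V) ⟶ L.mkObj d V := L.mkHom h le_rfl

/-- The relative Beck-Chevalley condition. -/
def RelativeBeckChevalley (L : FrmOpenDoctrine.{v, u, w}) : Prop :=
  ∀ {e d : L.base} (h : e ⟶ d) (V : L.fib d) (S : Sieve (L.mkObj d V)),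
    V = L.sieveSup S → L.pull h V = L.sieveSup (S.pullback (L.cartesian h V))

theorem le_sieveSup (L : FrmOpenDoctrine.{v, u, w}) {X Y : L.Total} (S : Sieve Y) (f : X ⟶ Y)
    (hf : S f) : L.ex (L.arr f) (L.val X) ≤ L.sieveSup S :=
  le_iSup_of_le X (le_iSup_of_le f (le_iSup_of_le hf le_rfl))

theorem sieveSup_le (L : FrmOpenDoctrine.{v, u, w}) {Y : L.Total} (S : Sieve Y)
    (V : L.fib (L.pt Y))
    (h : ∀ (X : L.Total) (f : X ⟶ Y), S f → L.ex (L.arr f) (L.val X) ≤ V) : L.sieveSup S ≤ V :=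
  iSup_le fun X => iSup_le fun f => iSup_le fun hf => h X f hf

theorem sieveSup_le_self (L : FrmOpenDoctrine.{v, u, w}) {Y : L.Total} (S : Sieve Y) :
    L.sieveSup S ≤ L.val Y :=
  L.sieveSup_le S _ fun _ f _ => (L.ex_gc _).l_le (L.val_le f)

end FrmOpenDoctrine

/-- A geometric doctrine: a doctrine valued in frames and open frame homomorphisms satisfying the
relative Beck-Chevalley condition. -/
structure GeometricDoctrine extends FrmOpenDoctrine.{v, u, w} where
  bc : toFrmOpenDoctrine.RelativeBeckChevalley

namespace GeometricDoctrine

theorem le_sieveSup_pullback (L : GeometricDoctrine.{v, u, w}) {e d : L.base} (h : e ⟶ d)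
    (W : L.fib e) (V : L.fib d) (hW : W ≤ L.pull h V) (S : Sieve (L.mkObj d V))
    (hS : V = L.sieveSup S) : W ≤ L.sieveSup (S.pullback (L.mkHom h hW)) := by
  have h1 : W = W ⊓ L.sieveSup (S.pullback (L.cartesian h V)) := by
    rw [← L.bc h V S hS]; exact (inf_eq_left.2 hW).symm
  refine h1.le.trans ?_
  rw [FrmOpenDoctrine.sieveSup]
  simp only [inf_iSup_eq]
  refine iSup_le fun Z => iSup_le fun g => iSup_le fun hg => ?_
  have hfr := L.ex_frobenius (L.arr g) (L.val Z) W
  rw [inf_comm]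
  refine hfr.ge.trans ?_
  let Z' : L.Total := L.mkObj (L.pt Z) (L.val Z ⊓ L.pull (L.arr g) W)
  let g' : Z' ⟶ L.mkObj e W := L.mkHom (L.arr g) inf_le_right
  let i : Z' ⟶ Z := Doctrine.Total.Hom.mk (P := L.toDoctrine) (𝟙 _) (by
    rw [Doctrine.pull_id]; exact (inf_le_left : L.val Z ⊓ L.pull (L.arr g) W ≤ L.val Z))
  have h3 := S.downward_closed hg i
  have h4 : i ≫ g ≫ L.cartesian h V = g' ≫ L.mkHom h hW :=
    Doctrine.Total.hom_ext (Category.id_comp _)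
  rw [h4] at h3
  exact L.le_sieveSup (S.pullback (L.mkHom h hW)) g' h3

/-- The topology `K_L` on `C ⋊ L`: a sieve `S` on `(d, V)` covers iff `V = ⋁_{f ∈ S} ∃_f U`. -/
noncomputable def topology (L : GeometricDoctrine.{v, u, w}) :
    GrothendieckTopology L.Total where
  sieves Y := {S | L.val Y = L.sieveSup S}
  top_mem' Y := by
    apply le_antisymm _ (L.sieveSup_le_self _)
    have h1 := L.le_sieveSup (⊤ : Sieve Y) (𝟙 Y) trivial
    have h2 := (L.ex_gc (𝟙 (L.pt Y))).le_u_l (L.val Y)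
    rw [L.pull_id] at h2
    exact h2.trans h1
  pullback_stable' X Y S h hS :=
    le_antisymm (L.le_sieveSup_pullback (L.arr h) (L.val Y) (L.val X) (L.val_le h) S hS)
      (L.sieveSup_le_self _)
  transitive' Y S hS R hR := by
    apply le_antisymm _ (L.sieveSup_le_self _)
    rw [show L.val Y = L.sieveSup S from hS]
    refine L.sieveSup_le _ _ fun X f hf => ?_
    rw [show L.val X = L.sieveSup (R.pullback f) from hR hf]
    refine (L.ex_gc _).l_le (L.sieveSup_le _ _ fun Z g hg => ?_)
    refine (L.ex_gc _).l_le ?_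
    have h1 := (L.ex_gc (L.arr (g ≫ f)) _ _).1 (L.le_sieveSup R (g ≫ f) hg)
    exact h1.trans (L.pull_comp (L.arr g) (L.arr f) _).le

/-- A geometric doctrine as the doctrinal site `(L, K_L)`. -/
noncomputable def toDocSite (L : GeometricDoctrine.{v, u, w}) : DocSite.{v, u, w} where
  toDoctrine := L.toDoctrine
  top := L.topology

end GeometricDoctrine

/-! ### The geometric completion -/

namespace DocSite

variable (P : DocSite.{v, u, w})

/-- Down-closed sets of pairs `(f, x)` with `f : d ⟶ c` and `x ∈ P(d)`. -/
@[ext]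
structure PreIdeal (c : P.base) where
  /-- Membership of the pair `(f, x)`. -/
  mem : ∀ ⦃d : P.base⦄, (d ⟶ c) → P.fib d → Prop
  down : ∀ ⦃d e : P.base⦄ (f : d ⟶ c) (x : P.fib d) (g : e ⟶ d) (y : P.fib e),
    mem f x → y ≤ P.pull g x → mem (g ≫ f) y

/-- The elements of the fibre over `c` of the geometric completion: the down-closed sets of
pairs which contain `(f, x)` as soon as they contain `(h ≫ f, y)` for all arrows
`h : (e, y) ⟶ (d, x)` of some covering sieve on `(d, x)`. -/
@[ext]
structure Ideal (c : P.base) extends P.PreIdeal c where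
  closed : ∀ ⦃d : P.base⦄ (f : d ⟶ c) (x : P.fib d) (R : Sieve (Doctrine.Total.mk d x)),
    R ∈ P.top (Doctrine.Total.mk d x) →
    (∀ ⦃Y : P.Total⦄ (h : Y ⟶ Doctrine.Total.mk d x), R h → mem (h.hom ≫ f) Y.elt) → mem f x

variable {P}

/-- The sieve on `(d, x)` of those `h : (e, y) ⟶ (d, x)` with `(h ≫ f, y) ∈ U`. -/
def PreIdeal.sieve {c : P.base} (U : P.PreIdeal c) {d : P.base} (f : d ⟶ c) (x : P.fib d) :
    Sieve (Doctrine.Total.mk (P := P.toDoctrine) d x) where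
  arrows Y h := U.mem (h.hom ≫ f) Y.elt
  downward_closed {Y Z h} hh g := by
    have := U.down _ _ g.hom Z.elt hh g.elt_le
    simpa using this

/-- The closure of a down-closed set of pairs with respect to the topology of `P`. -/
def PreIdeal.closure {c : P.base} (U : P.PreIdeal c) : P.Ideal c where
  mem d f x := U.sieve f x ∈ P.top (Doctrine.Total.mk d x)
  down d e f x g y h hy := by
    let g' : Doctrine.Total.mk (P := P.toDoctrine) e y ⟶ Doctrine.Total.mk d x := ⟨g, hy⟩
    have h1 := P.top.pullback_stable g' h
    convert h1 using 1
    ext Y k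
    simp [PreIdeal.sieve, g']
  closed d f x R hR h := by
    refine P.top.transitive hR _ fun Y g hg => ?_
    have := h g hg
    convert this using 1
    ext Z k
    simp [PreIdeal.sieve]

namespace Ideal

variable {c : P.base}

instance : PartialOrder (P.Ideal c) where
  le S T := ∀ ⦃d : P.base⦄ (f : d ⟶ c) (x : P.fib d), S.mem f x → T.mem f x
  le_refl _ _ _ _ h := h
  le_trans _ _ _ h₁ h₂ _ _ _ h := h₂ _ _ (h₁ _ _ h)
  le_antisymm S T h₁ h₂ := by
    ext d f x
    exact ⟨h₁ f x, h₂ f x⟩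

theorem subset_closure (U : P.PreIdeal c) {d : P.base} (f : d ⟶ c) (x : P.fib d)
    (h : U.mem f x) : U.closure.mem f x := by
  have : U.sieve f x = ⊤ := by
    ext Y k
    simpa [PreIdeal.sieve] using U.down f x k.hom Y.elt h k.elt_le
  change U.sieve f x ∈ _
  rw [this]
  exact P.top.top_mem _

theorem closure_le (U : P.PreIdeal c) (T : P.Ideal c)
    (h : ∀ ⦃d : P.base⦄ (f : d ⟶ c) (x : P.fib d), U.mem f x → T.mem f x) : U.closure ≤ T :=
  fun _ f x hx => T.closed f x _ hx fun _ k hk => h (k.hom ≫ f) _ hk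

/-- The union of a set of ideals. -/
def union (A : Set (P.Ideal c)) : P.PreIdeal c where
  mem _ f x := ∃ S ∈ A, S.mem f x
  down _ _ f x g y := fun ⟨S, hS, hx⟩ hy => ⟨S, hS, S.down f x g y hx hy⟩

/-- The fibres of the geometric completion are complete lattices under inclusion: meets are
intersections and joins are closures of unions. -/
instance : CompleteLattice (P.Ideal c) where
  sup S T := (union {S, T}).closure
  le_sup_left S T d f x h := subset_closure _ f x ⟨S, by simp, h⟩
  le_sup_right S T d f x h := subset_closure _ f x ⟨T, by simp, h⟩
  sup_le S T R h₁ h₂ := closure_le _ _ (by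
    rintro d f x ⟨U, rfl | rfl, hx⟩
    · exact h₁ f x hx
    · exact h₂ f x hx)
  inf S T :=
    { mem := fun _ f x => S.mem f x ∧ T.mem f x
      down := fun _ _ f x g y h hy => ⟨S.down f x g y h.1 hy, T.down f x g y h.2 hy⟩
      closed := fun _ f x R hR h =>
        ⟨S.closed f x R hR fun _ k hk => (h k hk).1, T.closed f x R hR fun _ k hk => (h k hk).2⟩ }
  inf_le_left _ _ _ _ _ h := h.1
  inf_le_right _ _ _ _ _ h := h.2
  le_inf _ _ _ h₁ h₂ _ f x h := ⟨h₁ f x h, h₂ f x h⟩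
  sSup A := (union A).closure
  isLUB_sSup A := ⟨fun S hS _ f x h => subset_closure _ f x ⟨S, hS, h⟩,
    fun _ h => closure_le _ _ fun _ f x ⟨_, hS, hx⟩ => h hS f x hx⟩
  sInf A :=
    { mem := fun _ f x => ∀ S ∈ A, S.mem f x
      down := fun _ _ f x g y h hy S hS => S.down f x g y (h S hS) hy
      closed := fun _ f x R hR h S hS => S.closed f x R hR fun _ k hk => h k hk S hS }
  isGLB_sInf A := ⟨fun S hS _ f x h => h S hS, fun _ h _ f x hx S hS => h hS f x hx⟩
  top :=
    { mem := fun _ _ _ => True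
      down := fun _ _ _ _ _ _ _ _ => trivial
      closed := fun _ _ _ _ _ _ => trivial }
  le_top _ _ _ _ _ := trivial
  bot := (union ∅).closure
  bot_le _ := closure_le _ _ (by rintro d f x ⟨_, h, -⟩; exact h.elim)

theorem mem_sSup {A : Set (P.Ideal c)} {d : P.base} {f : d ⟶ c} {x : P.fib d} :
    (sSup A).mem f x ↔ (union A).sieve f x ∈ P.top (Doctrine.Total.mk d x) := Iff.rfl

theorem mem_inf {S T : P.Ideal c} {d : P.base} {f : d ⟶ c} {x : P.fib d} :
    (S ⊓ T).mem f x ↔ S.mem f x ∧ T.mem f x := Iff.rfl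

instance : Order.Frame (P.Ideal c) := Order.Frame.ofMinimalAxioms
  { inf_sSup_le_iSup_inf := fun S A d f x h => by
      refine Ideal.closed _ f x _ (mem_sSup.1 h.2) fun Y k hk => ?_
      obtain ⟨T, hT, hx⟩ := hk
      have h1 : S ⊓ T ≤ ⨆ T ∈ A, S ⊓ T := le_iSup₂_of_le T hT le_rfl
      exact h1 _ _ ⟨S.down f x k.hom Y.elt h.1 k.elt_le, hx⟩ }

/-- The pullback `f^*(S) = {(g, y) | (g ≫ f, y) ∈ S}`. -/
def pullback {d c : P.base} (f : d ⟶ c) (S : P.Ideal c) : P.Ideal d where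
  mem _ g y := S.mem (g ≫ f) y
  down _ _ g x h y hx hy := by
    rw [Category.assoc]
    exact S.down (g ≫ f) x h y hx hy
  closed _ g x R hR h := S.closed (g ≫ f) x R hR fun Y k hk => by
    have := h k hk
    rwa [Category.assoc] at this

/-- The pullback as a frame homomorphism. -/
def pullbackHom {d c : P.base} (f : d ⟶ c) : FrameHom (P.Ideal c) (P.Ideal d) where
  toFun := pullback f
  map_inf' _ _ := rfl
  map_top' := rfl
  map_sSup' A := by
    apply le_antisymm
    · intro e g x h
      refine Ideal.closed _ g x _ (mem_sSup.1 h) fun Y k hk => ?_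
      obtain ⟨S, hS, hx⟩ := hk
      have h1 : pullback f S ≤ sSup (pullback f '' A) := le_sSup (Set.mem_image_of_mem _ hS)
      refine h1 _ _ ?_
      change S.mem _ _
      rwa [Category.assoc]
    · refine sSup_le ?_
      rintro _ ⟨S, hS, rfl⟩ e g x h
      have h1 : S ≤ sSup A := le_sSup hS
      exact h1 _ _ h

/-- The set of pairs `(k ≫ f, x)` with `(k, x) ∈ S`. -/
def image {d c : P.base} (f : d ⟶ c) (S : P.Ideal d) : P.PreIdeal c where
  mem e g x := ∃ k : e ⟶ d, k ≫ f = g ∧ S.mem k x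
  down _ _ g x h y := by
    rintro ⟨k, rfl, hk⟩ hy
    exact ⟨h ≫ k, by simp, S.down k x h y hk hy⟩

theorem image_gc {d c : P.base} (f : d ⟶ c) :
    GaloisConnection (fun S : P.Ideal d => (image f S).closure) (pullbackHom f) := by
  intro S T
  constructor
  · intro h e k x hx
    exact h _ _ (subset_closure _ _ _ ⟨k, rfl, hx⟩)
  · intro h
    refine closure_le _ _ ?_
    rintro e _ x ⟨k, rfl, hx⟩
    exact h k x hx

theorem pullbackHom_isOpen {d c : P.base} (f : d ⟶ c) :
    IsOpenFrameHom (pullbackHom (P := P) f) := by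
  refine ⟨fun S => (image f S).closure, image_gc f, fun S T => le_antisymm ?_ ?_⟩
  · refine (image_gc f).l_le (le_inf (inf_le_left.trans ((image_gc f).le_u_l S)) inf_le_right)
  · intro e g x h
    refine Ideal.closed _ g x _ (show (image f S).sieve g x ∈ _ from h.1) fun Y k hk => ?_
    obtain ⟨l, hl, hx⟩ := hk
    refine subset_closure _ _ _ ⟨l, hl, hx, ?_⟩
    change T.mem (l ≫ f) _
    rw [hl]
    exact T.down g x k.hom Y.elt h.2 k.elt_le

end Ideal

variable (P)

/-- The geometric completion of a doctrinal site, as a doctrine valued in frames and open frame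
homomorphisms. -/
def completionFrm : FrmOpenDoctrine.{v, u, w} where
  base := P.base
  fn :=
    { obj := fun c => Frm.of (P.Ideal c.unop)
      map := fun f => Frm.ofHom (Ideal.pullbackHom f.unop)
      map_id := fun c => by
        ext S d g x
        change S.mem (g ≫ 𝟙 _) x ↔ S.mem g x
        rw [Category.comp_id]
      map_comp := fun f h => by
        ext S d g x
        change S.mem (g ≫ h.unop ≫ f.unop) x ↔ S.mem ((g ≫ h.unop) ≫ f.unop) x
        rw [Category.assoc] }
  isOpen f := Ideal.pullbackHom_isOpen f

theorem completion_ex {d c : P.completionFrm.base} (f : d ⟶ c) (S : P.completionFrm.fib d) :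
    P.completionFrm.ex f S = (Ideal.image (P := P) (d := d) (c := c) f S).closure :=
  (P.completionFrm.ex_gc f).l_unique (Ideal.image_gc f) (fun _ => rfl)

theorem completion_bc : P.completionFrm.RelativeBeckChevalley := by
  intro e d h V S hV
  refine le_antisymm ?_ (P.completionFrm.sieveSup_le_self _)
  refine ((OrderHomClass.mono (P.completionFrm.pull h)) hV.le).trans ?_
  rw [FrmOpenDoctrine.sieveSup]
  simp only [map_iSup]
  refine iSup_le fun X => iSup_le fun f => iSup_le fun hf => ?_
  rw [completion_ex]
  intro k m x hx
  refine Ideal.closed _ m x _ hx fun Y n hn => ?_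
  obtain ⟨l, hl, hy⟩ := hn
  have hl' : l ≫ P.completionFrm.arr f = (n.hom ≫ m) ≫ h := hl.trans (Category.assoc _ _ _).symm
  have hUV : P.completionFrm.val X ≤ P.completionFrm.pull (P.completionFrm.arr f) V :=
    P.completionFrm.val_le f
  let Z : P.completionFrm.Total :=
    P.completionFrm.mkObj Y.base (P.completionFrm.pull l (P.completionFrm.val X))
  let g : Z ⟶ P.completionFrm.mkObj e (P.completionFrm.pull h V) :=
    P.completionFrm.mkHom (n.hom ≫ m) (by
      refine ((OrderHomClass.mono (P.completionFrm.pull l)) hUV).trans (le_of_eq ?_)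
      have e1 := P.completionFrm.pull_comp l (P.completionFrm.arr f) V
      have e2 := P.completionFrm.pull_comp (e := Y.base) (n.hom ≫ m) h V
      have e3 := congrArg (fun q => P.completionFrm.pull q V) hl'
      exact e1.symm.trans (e3.trans e2))
  have hg : S.pullback (P.completionFrm.cartesian h V) g := by
    have h1 := S.downward_closed hf (P.completionFrm.cartesian l (P.completionFrm.val X))
    have h2 : P.completionFrm.cartesian l (P.completionFrm.val X) ≫ f =
        g ≫ P.completionFrm.cartesian h V := Doctrine.Total.hom_ext hl'
    rw [h2] at h1
    exact h1
  have h3 := P.completionFrm.le_sieveSup _ g hg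
  rw [completion_ex] at h3
  refine h3 _ _ (Ideal.subset_closure _ _ _ ⟨𝟙 _, Category.id_comp _, ?_⟩)
  change (P.completionFrm.val X : P.Ideal _).mem (𝟙 _ ≫ l) _
  rw [Category.id_comp]
  exact hy

/-- The geometric completion `ℨ(P, J)` of a doctrinal site. -/
def completion : GeometricDoctrine.{v, u, w} where
  toFrmOpenDoctrine := P.completionFrm
  bc := P.completion_bc

/-- The principal down-set `↓x`. -/
def principal {P : DocSite.{v, u, w}} {c : P.base} (x : P.fib c) : P.PreIdeal c where
  mem _ g y := y ≤ P.pull g x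
  down _ _ g y h z hy hz := by
    rw [Doctrine.pull_comp]
    exact hz.trans ((P.pull h).monotone hy)

/-- The unit `η : P ⟶ ℨ(P, J)`, sending `x` to the closure of `↓x`. -/
def unit : P.fn ⟶ (𝟭 P.base).op ⋙ P.completion.toDoctrine.fn where
  app c := Preord.ofHom
    { toFun := fun x => (principal (c := c.unop) x).closure
      monotone' := fun x y hxy => Ideal.closure_le _ _ fun _ f _ hz =>
        Ideal.subset_closure _ _ _ (hz.trans ((P.pull f).monotone hxy)) }
  naturality c d f := by
    ext x
    refine Ideal.ext ?_
    funext e g y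
    change ((principal (P.pull f.unop x)).sieve g y ∈ P.top _) =
      ((principal (P := P) x).sieve (g ≫ f.unop) y ∈ P.top _)
    congr 1
    ext Z k
    change Z.elt ≤ P.pull _ _ ↔ Z.elt ≤ P.pull _ _
    rw [← Doctrine.pull_comp, Category.assoc]

end DocSite
/-! ### Strict 2-categorical notions

A 2-category is a strict bicategory and a 2-functor is a strict pseudofunctor. Equalities between
2-cells whose boundaries agree only by a proved equality of 1-cells are mediated by `eqToHom`,
the identity 2-cell along an equality of 1-cells. -/

section TwoCategories

open Bicategory

variable {B : Type u₁} [Bicategory.{w₁, v₁} B] {C : Type u₂} [Bicategory.{w₂, v₂} C]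

/-- A strict 2-monad `(T, η, μ)`, with `η` and `μ` 2-natural. -/
structure TwoMonad (B : Type u₁) [Bicategory.{w₁, v₁} B] where
  /-- The underlying 2-endofunctor. -/
  T : StrictPseudofunctor B B
  /-- The unit. -/
  η : ∀ X : B, X ⟶ T.obj X
  η_naturality : ∀ {X Y : B} (f : X ⟶ Y), f ≫ η Y = η X ≫ T.map f
  η_naturality₂ : ∀ {X Y : B} {f g : X ⟶ Y} (α : f ⟶ g),
    α ▷ η Y ≫ eqToHom (η_naturality g) = eqToHom (η_naturality f) ≫ η X ◁ T.map₂ α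
  /-- The multiplication. -/
  μ : ∀ X : B, T.obj (T.obj X) ⟶ T.obj X
  μ_naturality : ∀ {X Y : B} (f : X ⟶ Y), T.map (T.map f) ≫ μ Y = μ X ≫ T.map f
  μ_naturality₂ : ∀ {X Y : B} {f g : X ⟶ Y} (α : f ⟶ g),
    T.map₂ (T.map₂ α) ▷ μ Y ≫ eqToHom (μ_naturality g) =
      eqToHom (μ_naturality f) ≫ μ X ◁ T.map₂ α
  assoc : ∀ X : B, T.map (μ X) ≫ μ X = μ (T.obj X) ≫ μ X
  unit_left : ∀ X : B, η (T.obj X) ≫ μ X = 𝟙 (T.obj X)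
  unit_right : ∀ X : B, T.map (η X) ≫ μ X = 𝟙 (T.obj X)

namespace TwoMonad

variable (M : TwoMonad B)

theorem map_η_naturality {X Y : B} (f : X ⟶ Y) :
    M.T.map f ≫ M.T.map (M.η Y) = M.T.map (M.η X) ≫ M.T.map (M.T.map f) := by
  rw [← M.T.map_comp, ← M.T.map_comp, M.η_naturality]

/-- A 2-monad `T` is lax-idempotent if there are 2-cells `lam X : T(η_X) ⟶ η_{TX}`, natural in
`X`, whose whiskerings with `η_X` and with `μ_X` are identity 2-cells. -/
def IsLaxIdempotent : Prop :=
  ∃ lam : ∀ X : B, M.T.map (M.η X) ⟶ M.η (M.T.obj X),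
    (∀ {X Y : B} (f : X ⟶ Y),
      M.T.map f ◁ lam Y ≫ eqToHom (M.η_naturality (M.T.map f)) =
        eqToHom (M.map_η_naturality f) ≫ lam X ▷ M.T.map (M.T.map f)) ∧
    (∀ X : B, M.η X ◁ lam X = eqToHom (M.η_naturality (M.η X)).symm) ∧
    (∀ X : B, lam X ▷ M.μ X = eqToHom ((M.unit_right X).trans (M.unit_left X).symm))

end TwoMonad

/-- A strict 2-adjunction `L ⊣ R`: 2-natural unit and counit satisfying the triangle identities
strictly. -/
structure TwoAdjunction (L : StrictPseudofunctor B C) (R : StrictPseudofunctor C B) where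
  /-- The unit. -/
  unit : ∀ X : B, X ⟶ R.obj (L.obj X)
  unit_naturality : ∀ {X Y : B} (f : X ⟶ Y), f ≫ unit Y = unit X ≫ R.map (L.map f)
  unit_naturality₂ : ∀ {X Y : B} {f g : X ⟶ Y} (α : f ⟶ g),
    α ▷ unit Y ≫ eqToHom (unit_naturality g) =
      eqToHom (unit_naturality f) ≫ unit X ◁ R.map₂ (L.map₂ α)
  /-- The counit. -/
  counit : ∀ Y : C, L.obj (R.obj Y) ⟶ Y
  counit_naturality : ∀ {X Y : C} (f : X ⟶ Y), L.map (R.map f) ≫ counit Y = counit X ≫ f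
  counit_naturality₂ : ∀ {X Y : C} {f g : X ⟶ Y} (α : f ⟶ g),
    L.map₂ (R.map₂ α) ▷ counit Y ≫ eqToHom (counit_naturality g) =
      eqToHom (counit_naturality f) ≫ counit X ◁ α
  left_triangle : ∀ X : B, L.map (unit X) ≫ counit (L.obj X) = 𝟙 (L.obj X)
  right_triangle : ∀ Y : C, unit (R.obj Y) ≫ R.map (counit Y) = 𝟙 (R.obj Y)

namespace TwoAdjunction

variable {L : StrictPseudofunctor B C} {R : StrictPseudofunctor C B}

theorem map₂_whiskerRight (F : StrictPseudofunctor B C) {X Y Z : B} {f f' : X ⟶ Y} (η : f ⟶ f')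
    (g : Y ⟶ Z) : F.map₂ η ▷ F.map g =
      eqToHom (F.map_comp f g).symm ≫ F.map₂ (η ▷ g) ≫ eqToHom (F.map_comp f' g) := by
  simp [F.map₂_whisker_right, F.mapComp_eq_eqToIso]

theorem map₂_whiskerLeft (F : StrictPseudofunctor B C) {X Y Z : B} (f : X ⟶ Y) {g g' : Y ⟶ Z}
    (η : g ⟶ g') : F.map f ◁ F.map₂ η =
      eqToHom (F.map_comp f g).symm ≫ F.map₂ (f ◁ η) ≫ eqToHom (F.map_comp f g') := by
  simp [F.map₂_whisker_left, F.mapComp_eq_eqToIso]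

theorem map_counit_naturality (adj : TwoAdjunction L R) {X Y : C} (f : X ⟶ Y) :
    R.map (L.map (R.map f)) ≫ R.map (adj.counit Y) = R.map (adj.counit X) ≫ R.map f := by
  rw [← R.map_comp, ← R.map_comp, adj.counit_naturality]

theorem map_counit_naturality₂ (adj : TwoAdjunction L R) {X Y : C} {f g : X ⟶ Y} (α : f ⟶ g) :
    R.map₂ (L.map₂ (R.map₂ α)) ▷ R.map (adj.counit Y) ≫ eqToHom (adj.map_counit_naturality g) =
      eqToHom (adj.map_counit_naturality f) ≫ R.map (adj.counit X) ◁ R.map₂ α := by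
  have h := congrArg R.map₂ (adj.counit_naturality₂ α)
  rw [PrelaxFunctor.map₂_comp, PrelaxFunctor.map₂_comp, PrelaxFunctor.map₂_eqToHom,
    PrelaxFunctor.map₂_eqToHom] at h
  rw [map₂_whiskerRight, map₂_whiskerLeft]
  have h' := congrArg (fun β => eqToHom (R.map_comp (L.map (R.map f)) (adj.counit Y)).symm ≫ β ≫
    eqToHom (R.map_comp (adj.counit X) g)) h
  simpa using h'

/-- The 2-monad `(R L, η, R ε L)` induced by a strict 2-adjunction. -/
def monad (adj : TwoAdjunction L R) : TwoMonad B where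
  T := L.comp R
  η := adj.unit
  η_naturality := adj.unit_naturality
  η_naturality₂ := adj.unit_naturality₂
  μ X := R.map (adj.counit (L.obj X))
  μ_naturality f := adj.map_counit_naturality (L.map f)
  μ_naturality₂ α := adj.map_counit_naturality₂ (L.map₂ α)
  assoc X := adj.map_counit_naturality (adj.counit (L.obj X))
  unit_left X := adj.right_triangle (L.obj X)
  unit_right X := by
    have := congrArg R.map (adj.left_triangle X)
    rw [R.map_comp, R.map_id] at this
    exact this

end TwoAdjunction

end TwoCategories
/-! ### 2-full 2-subcategories -/

/-- A 2-full 2-subcategory of `B`: a class of objects and a class of 1-cells between them, closed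
under identities and composition; all 2-cells of `B` between such 1-cells are included. -/
structure TwoFullSub (B : Type u₁) [Bicategory.{w₁, v₁} B] where
  /-- The objects. -/
  obj : B → Prop
  /-- The 1-cells (only their values between objects of the 2-subcategory matter). -/
  hom : ∀ {X Y : B}, (X ⟶ Y) → Prop
  id_mem : ∀ {X : B}, obj X → hom (𝟙 X)
  comp_mem : ∀ {X Y Z : B} (f : X ⟶ Y) (g : Y ⟶ Z), obj X → obj Y → obj Z →
    hom f → hom g → hom (f ≫ g)

namespace TwoFullSub

open Bicategory

variable {B : Type u₁} [Bicategory.{w₁, v₁} B]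

/-- The objects of a 2-full 2-subcategory. -/
structure Obj (A : TwoFullSub B) where
  /-- The underlying object. -/
  val : B
  mem : A.obj val

variable {A : TwoFullSub B}

/-- The 1-cells of a 2-full 2-subcategory. -/
@[ext]
structure Hom (X Y : A.Obj) where
  /-- The underlying 1-cell. -/
  val : X.val ⟶ Y.val
  mem : A.hom val

instance : CategoryStruct A.Obj where
  Hom X Y := Hom X Y
  id X := ⟨𝟙 X.val, A.id_mem X.mem⟩
  comp {X Y Z} f g := ⟨f.val ≫ g.val, A.comp_mem _ _ X.mem Y.mem Z.mem f.mem g.mem⟩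

@[ext]
theorem hom_ext {X Y : A.Obj} {f g : X ⟶ Y} (h : f.val = g.val) : f = g := Hom.ext h

@[simp]
theorem id_val (X : A.Obj) : Hom.val (𝟙 X) = 𝟙 X.val := rfl

@[simp]
theorem comp_val {X Y Z : A.Obj} (f : X ⟶ Y) (g : Y ⟶ Z) :
    Hom.val (f ≫ g) = f.val ≫ g.val := rfl

/-- The 2-cells of a 2-full 2-subcategory. -/
@[ext]
structure Hom₂ {X Y : A.Obj} (f g : X ⟶ Y) where
  /-- The underlying 2-cell. -/
  val : f.val ⟶ g.val

@[simps]
instance homCategory (X Y : A.Obj) : Category (X ⟶ Y) where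
  Hom f g := Hom₂ f g
  id f := ⟨𝟙 f.val⟩
  comp α β := ⟨α.val ≫ β.val⟩

@[ext]
theorem hom₂_ext {X Y : A.Obj} {f g : X ⟶ Y} {α β : f ⟶ g} (h : α.val = β.val) : α = β :=
  Hom₂.ext h

/-- Invertible 2-cells of a 2-full 2-subcategory. -/
@[simps]
def isoMk {X Y : A.Obj} {f g : X ⟶ Y} (e : f.val ≅ g.val) : f ≅ g where
  hom := ⟨e.hom⟩
  inv := ⟨e.inv⟩
  hom_inv_id := by ext1; exact e.hom_inv_id
  inv_hom_id := by ext1; exact e.inv_hom_id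

instance : Bicategory A.Obj where
  homCategory := homCategory
  whiskerLeft f _ _ η := Hom₂.mk (f.val ◁ η.val)
  whiskerRight η h := Hom₂.mk (η.val ▷ h.val)
  associator f g h := isoMk (α_ f.val g.val h.val)
  leftUnitor f := isoMk (λ_ f.val)
  rightUnitor f := isoMk (ρ_ f.val)
  whisker_exchange η θ := hom₂_ext (whisker_exchange η.val θ.val)

@[simp]
theorem whiskerLeft_val {X Y Z : A.Obj} (f : X ⟶ Y) {g h : Y ⟶ Z} (η : g ⟶ h) :
    (f ◁ η).val = f.val ◁ η.val := rfl

@[simp]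
theorem whiskerRight_val {X Y Z : A.Obj} {f g : X ⟶ Y} (η : f ⟶ g) (h : Y ⟶ Z) :
    (η ▷ h).val = η.val ▷ h.val := rfl

theorem eqToHom_val {X Y : A.Obj} {f g : X ⟶ Y} (h : f = g) :
    Hom₂.val (eqToHom h) = eqToHom (congrArg Hom.val h) := by
  subst h; rfl

instance [Strict B] : Strict A.Obj where
  id_comp f := hom_ext (Strict.id_comp f.val)
  comp_id f := hom_ext (Strict.comp_id f.val)
  assoc f g h := hom_ext (Strict.assoc f.val g.val h.val)
  leftUnitor_eqToIso f := by
    ext1; apply hom₂_ext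
    simp only [eqToIso.hom, eqToHom_val]
    exact congrArg Iso.hom (Strict.leftUnitor_eqToIso f.val)
  rightUnitor_eqToIso f := by
    ext1; apply hom₂_ext
    simp only [eqToIso.hom, eqToHom_val]
    exact congrArg Iso.hom (Strict.rightUnitor_eqToIso f.val)
  associator_eqToIso f g h := by
    ext1; apply hom₂_ext
    simp only [eqToIso.hom, eqToHom_val]
    exact congrArg Iso.hom (Strict.associator_eqToIso f.val g.val h.val)

end TwoFullSub

/-! ### Coarse geometric completions -/

/-- The data of a coarse geometric completion. -/
structure CoarseGeometricCompletion where
  /-- The 2-full 2-subcategory `A-Doc` of the 2-category of doctrinal sites. -/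
  doc : TwoFullSub DocSite.{v, u, w}
  /-- The objects of `GeomDoc_A`. -/
  geom : GeometricDoctrine.{v, u, w} → Prop
  /-- The chosen topology `J^A_L` on `C ⋊ L`. -/
  top : ∀ L : GeometricDoctrine.{v, u, w}, geom L → GrothendieckTopology L.Total
  top_le : ∀ (L : GeometricDoctrine.{v, u, w}) (hL : geom L), top L hL ≤ L.topology
  top_mem : ∀ (L : GeometricDoctrine.{v, u, w}) (hL : geom L), doc.obj ⟨L.toDoctrine, top L hL⟩
  /-- Every morphism of geometric doctrines `(F, a) : L ⟶ L'` is also a morphism of `A`-doctrines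
  `(L, J^A_L) ⟶ (L', J^A_L')`. -/
  top_functorial : ∀ (L L' : GeometricDoctrine.{v, u, w}) (hL : geom L) (hL' : geom L')
    (f : L.toDocSite ⟶ L'.toDocSite),
    ∃ h : IsMorphismOfSites (top L hL) (top L' hL') (Doctrine.totalMap f.F f.a),
      doc.hom (X := ⟨L.toDoctrine, top L hL⟩) (Y := ⟨L'.toDoctrine, top L' hL'⟩)
        ⟨f.F, f.a, f.flat, h⟩
  completion_mem : ∀ P : DocSite.{v, u, w}, doc.obj P → geom P.completion
  /-- The unit is a morphism of `A`-doctrines `(P, J) ⟶ (ℨ(P, J), J^A_{ℨ(P, J)})`. -/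
  unit_mem : ∀ (P : DocSite.{v, u, w}) (hP : doc.obj P),
    ∃ h : IsMorphismOfSites P.top (top P.completion (completion_mem P hP))
        (Doctrine.totalMap (Q := P.completion.toDoctrine) (𝟭 P.base) P.unit),
      doc.hom (X := P) (Y := ⟨P.completion.toDoctrine, top P.completion (completion_mem P hP)⟩)
        ⟨𝟭 P.base, P.unit, IsMorphismOfSites.id _, h⟩

namespace CoarseGeometricCompletion

open Bicategory

variable (A : CoarseGeometricCompletion.{v, u, w})

/-- The 2-category `A-Doc`. -/
abbrev ADoc := A.doc.Obj

/-- The 2-category `GeomDoc_A`, full on 1-cells and 2-cells in the 2-category of doctrinal sites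
via `L ↦ (L, K_L)`. -/
abbrev GeomDoc := InducedBicategory DocSite.{v, u, w}
  (fun L : {L : GeometricDoctrine.{v, u, w} // A.geom L} => L.1.toDocSite)

/-- The object `(L, J^A_L)` of `A-Doc`. -/
noncomputable def embObj (L : A.GeomDoc) : A.ADoc :=
  ⟨⟨L.1.toDoctrine, A.top L.1 L.2⟩, A.top_mem L.1 L.2⟩

/-- The 2-full 2-embedding `GeomDoc_A ⥤ A-Doc`, sending `L` to `(L, J^A_L)` and acting as the
identity on the data of 1-cells and 2-cells. -/
noncomputable def embedding : StrictPseudofunctor A.GeomDoc A.ADoc :=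
  StrictPseudofunctor.mk''
    { obj := A.embObj
      map := fun {L L'} f => TwoFullSub.Hom.mk (X := A.embObj L) (Y := A.embObj L')
        ⟨f.hom.F, f.hom.a, f.hom.flat, (A.top_functorial L.1 L'.1 L.2 L'.2 f.hom).choose⟩
        (A.top_functorial L.1 L'.1 L.2 L'.2 f.hom).choose_spec
      map₂ := fun α => ⟨⟨α.hom.nat, α.hom.fib_le⟩⟩
      map₂_whisker_left := fun f _ _ η => by
        refine Eq.trans ?_ ((Category.id_comp _).trans (Category.comp_id _)).symm
        rfl
      map₂_whisker_right := fun η f => by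
        refine Eq.trans ?_ ((Category.id_comp _).trans (Category.comp_id _)).symm
        rfl }

/-- The object part of `ℨ_A : A-Doc ⥤ GeomDoc_A`. -/
noncomputable def completion (P : A.ADoc) : A.GeomDoc := ⟨P.val.completion, A.completion_mem P.val P.mem⟩

/-- The unit as a 1-cell of `A-Doc`. -/
noncomputable def unit (P : A.ADoc) : P ⟶ A.embedding.obj (A.completion P) :=
  TwoFullSub.Hom.mk (X := P) (Y := A.embObj (A.completion P))
    ⟨𝟭 P.val.base, P.val.unit, IsMorphismOfSites.id _, (A.unit_mem P.val P.mem).choose⟩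
    (A.unit_mem P.val P.mem).choose_spec

end CoarseGeometricCompletion
end CoarseGeom

namespace CoarseGeom

/-! Let `(F, a)` be a 1-cell from `(P, J)` to a geometric doctrine `L`. The unit `η` lies over the
identity functor, so an extension along it must have base functor exactly `F`. An ideal `U` over `c`
is the join of the `∃_g (η x)` with `(g, x) ∈ U`, and a morphism of geometric doctrines preserves
covers, so the extension must send `U` to the join of the `∃_{F g} (a x)`. This formula is left
adjoint to `v ↦ {(g, x) | a x ≤ L(F g)(v)}`, a set closed under `J` because `F ⋊ a` preserves covers
(`gc_extend_restrict`).

It remains to see that the formula defines a morphism of geometric doctrines. The relative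
Beck-Chevalley condition, in the form of pullback stability of `K_L`, allows an element below a
pullback of the join to be replaced locally by elements below a pullback of a single `a x`
(`le_of_le_extend`). Flatness of `F` then gives compatibility with transition maps
(`extend_pullback`), and local filtering of `F ⋊ a` together with flatness of `F` gives binary meets
(`extend_inf`). Cover preservation is transposed through the adjunction.

Since `J^A_L ⊆ K_L`, every 1-cell of `A-Doc` into `(L, J^A_L)` is also one into `(L, K_L)`. Its
extension lies in `GeomDoc_A` by fullness and returns to `A-Doc` by condition 1. Composition with
`η` is therefore a strict bijection on 1-cells (`unit_lift`, `lift_unit`). A 2-cell extends with the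
same underlying natural transformation (`extend_le`). Functoriality and the triangle identities
follow from uniqueness, and the equations of 2-cells from comparing components.

For lax idempotency, `T η` and `η T` both lie over the identity functor. If `(g, x) ∈ U` then `η x ≤
g^* U`, so `∃_g (η (η x)) ≤ η U`. Hence `T η ≤ η T` fibrewise, the 2-cell sits over an identity
transformation, and so do all the required equations. -/

theorem IsMorphismOfSites.mono_right {C : Type u₁} [Category.{v₁} C] {D : Type u₂}
    [Category.{v₂} D] {J : GrothendieckTopology C} {K K' : GrothendieckTopology D} {F : C ⥤ D}
    (h : IsMorphismOfSites J K F) (hK : K ≤ K') : IsMorphismOfSites J K' F where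
  cover_preserving S hS := hK _ (h.cover_preserving S hS)
  cover_obj d := (h.cover_obj d).imp fun _ hS => ⟨hK _ hS.1, hS.2⟩
  cover_span g₁ g₂ := (h.cover_span g₁ g₂).imp fun _ hS => ⟨hK _ hS.1, hS.2⟩
  cover_equalizer f₁ f₂ _ g hg :=
    (h.cover_equalizer f₁ f₂ g hg).imp fun _ hS => ⟨hK _ hS.1, hS.2⟩

/-! ### Flat functors: global factorisations -/

namespace IsFlat

variable {C : Type u₁} [Category.{v₁} C] {D : Type u₂} [Category.{v₂} D] {F : C ⥤ D}

theorem exists_span (hF : IsFlat F) {c₁ c₂ : C} {d : D} (g₁ : d ⟶ F.obj c₁) (g₂ : d ⟶ F.obj c₂) :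
    ∃ (c : C) (f₁ : c ⟶ c₁) (f₂ : c ⟶ c₂) (k : d ⟶ F.obj c),
      k ≫ F.map f₁ = g₁ ∧ k ≫ F.map f₂ = g₂ := by
  obtain ⟨S, hS, h⟩ := IsMorphismOfSites.cover_span hF g₁ g₂
  -- Only the maximal sieve covers for the trivial topology, so the local factorisation can be
  -- evaluated at the identity.
  rw [GrothendieckTopology.trivial_covering] at hS
  subst hS
  simpa using h (𝟙 d) trivial

theorem exists_equalizer (hF : IsFlat F) {c' c : C} (f₁ f₂ : c' ⟶ c) {d : D} (g : d ⟶ F.obj c')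
    (hg : g ≫ F.map f₁ = g ≫ F.map f₂) :
    ∃ (b : C) (e : b ⟶ c') (k : d ⟶ F.obj b), e ≫ f₁ = e ≫ f₂ ∧ k ≫ F.map e = g := by
  obtain ⟨S, hS, h⟩ := IsMorphismOfSites.cover_equalizer hF f₁ f₂ g hg
  rw [GrothendieckTopology.trivial_covering] at hS
  subst hS
  simpa using h (𝟙 d) trivial

/-- A flat functor sends commutative squares over its image back to commutative squares. -/
theorem exists_square (hF : IsFlat F) {c₁ c₂ c : C} (p₁ : c₁ ⟶ c) (p₂ : c₂ ⟶ c) {d : D}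
    (g₁ : d ⟶ F.obj c₁) (g₂ : d ⟶ F.obj c₂) (h : g₁ ≫ F.map p₁ = g₂ ≫ F.map p₂) :
    ∃ (b : C) (f₁ : b ⟶ c₁) (f₂ : b ⟶ c₂) (k : d ⟶ F.obj b),
      f₁ ≫ p₁ = f₂ ≫ p₂ ∧ k ≫ F.map f₁ = g₁ ∧ k ≫ F.map f₂ = g₂ := by
  -- The legs of the span need not commute with `p₁` and `p₂`, but `F` identifies the two composites
  -- after `k`; the equalizer condition corrects this.
  obtain ⟨m, f₁, f₂, k, rfl, rfl⟩ := hF.exists_span g₁ g₂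
  obtain ⟨b, e, l, he, rfl⟩ := hF.exists_equalizer (f₁ ≫ p₁) (f₂ ≫ p₂) k (by simpa using h)
  exact ⟨b, e ≫ f₁, e ≫ f₂, l, by simpa using he, by simp, by simp⟩

end IsFlat

/-! ### Covers of a geometric doctrine, tested by inequalities -/

namespace GeometricDoctrine

variable {L : GeometricDoctrine.{v, u, w}}

/-- Transposing each `∃_k U ≤ v` to `U ≤ L(k)(v)` removes the left adjoints: to prove an inequality
out of a covered element it suffices to prove it on the members of the cover. -/
theorem mem_topology_iff {Y : L.Total} {R : Sieve Y} :
    R ∈ L.topology Y ↔ ∀ v : L.fib (L.pt Y),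
      (∀ (X : L.Total) (k : X ⟶ Y), R k → L.val X ≤ L.pull (L.arr k) v) → L.val Y ≤ v := by
  constructor
  · intro hR v h
    rw [show L.val Y = L.sieveSup R from hR]
    exact L.sieveSup_le _ _ fun X k hk => (L.ex_gc _).l_le (h X k hk)
  · intro h
    exact le_antisymm (h _ fun X k hk => (L.ex_gc _ _ _).1 (L.le_sieveSup R k hk))
      (L.sieveSup_le_self _)

theorem le_of_covering {d : L.base} {W v : L.fib d} {R : Sieve (L.mkObj d W)}
    (hR : R ∈ L.topology (L.mkObj d W))
    (h : ∀ (e : L.base) (k : e ⟶ d) (V : L.fib e) (hV : V ≤ L.pull k W), R (L.mkHom k hV) →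
      V ≤ L.pull k v) : W ≤ v :=
  mem_topology_iff.1 hR v fun _ k hk => h _ _ _ (L.val_le k) hk

end GeometricDoctrine

/-! ### Extension of a morphism to the geometric completion -/

namespace DocSite

variable {P : DocSite.{v, u, w}} {L : GeometricDoctrine.{v, u, w}}

namespace Hom

/-- The base functor of a morphism into a geometric doctrine. -/
abbrev baseFunctor (f : DocSite.Hom P L.toDocSite) : P.base ⥤ L.base := f.F

/-- The fibre maps of a morphism into a geometric doctrine. -/
noncomputable def fibMap (f : DocSite.Hom P L.toDocSite) {c : P.base} (x : P.fib c) :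
    L.fib (f.baseFunctor.obj c) := Doctrine.comp f.a c x

variable (f : DocSite.Hom P L.toDocSite)

theorem fibMap_mono {c : P.base} {x y : P.fib c} (h : x ≤ y) : f.fibMap x ≤ f.fibMap y :=
  (Doctrine.comp f.a c).monotone h

theorem fibMap_pull {d c : P.base} (g : d ⟶ c) (x : P.fib c) :
    f.fibMap (P.pull g x) = L.pull (f.baseFunctor.map g) (f.fibMap x) :=
  Doctrine.comp_pull f.a g x

theorem fibMap_le_pull {d c : P.base} {g : d ⟶ c} {y : P.fib d} {x : P.fib c}
    (h : y ≤ P.pull g x) : f.fibMap y ≤ L.pull (f.baseFunctor.map g) (f.fibMap x) :=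
  (f.fibMap_mono h).trans (f.fibMap_pull g x).le

/-- The image of a covering sieve generates a cover of `(F c, a x)`, and an inequality known on
generators passes to every arrow factoring through one. This is what makes `restrict` land in
ideals. -/
theorem fibMap_le_of_covering {c : P.base} {x : P.fib c} {v : L.fib (f.baseFunctor.obj c)}
    {R : Sieve (Doctrine.Total.mk c x)} (hR : R ∈ P.top (Doctrine.Total.mk c x))
    (h : ∀ ⦃Y : P.Total⦄ (k : Y ⟶ Doctrine.Total.mk c x), R k →
      f.fibMap Y.elt ≤ L.pull (f.baseFunctor.map k.hom) v) : f.fibMap x ≤ v := by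
  refine GeometricDoctrine.le_of_covering (f.site.cover_preserving R hR) ?_
  rintro e k V hV ⟨Z, g, l, hg, hk⟩
  obtain ⟨l, hl, rfl⟩ : ∃ l : e ⟶ f.baseFunctor.obj Z.base,
      V ≤ L.pull l (f.fibMap Z.elt) ∧ l ≫ f.baseFunctor.map g.hom = k :=
    ⟨L.arr l, L.val_le l, (congrArg Doctrine.Total.Hom.hom hk).symm⟩
  rw [L.pull_comp]
  exact hl.trans (OrderHomClass.mono _ (h g hg))

/-- The right adjoint of the extension of `f` to the geometric completion. -/
noncomputable def restrict {c : P.base} (v : L.fib (f.baseFunctor.obj c)) : P.Ideal c where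
  mem _ g x := f.fibMap x ≤ L.pull (f.baseFunctor.map g) v
  down _ _ g x h y hx hy := by
    rw [Functor.map_comp, L.pull_comp]
    exact (f.fibMap_le_pull hy).trans (OrderHomClass.mono _ hx)
  closed _ g x R hR h := f.fibMap_le_of_covering hR fun Y k hk => by
    have := h k hk
    rwa [Functor.map_comp, L.pull_comp] at this

/-- The fibre map of the extension of `f` to the geometric completion. -/
noncomputable def extend {c : P.base} (U : P.Ideal c) : L.fib (f.baseFunctor.obj c) :=
  ⨆ (d : P.base) (g : d ⟶ c) (x : P.fib d) (_ : U.mem g x),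
    L.ex (f.baseFunctor.map g) (f.fibMap x)

/-- A join lies below `v` iff each `∃_{F g} (a x)` does, that is, iff `a x ≤ L(F g)(v)` for every
member of `U`. -/
theorem gc_extend_restrict {c : P.base} :
    GaloisConnection (f.extend (c := c)) (f.restrict (c := c)) := fun U v => by
  simp only [extend, iSup_le_iff]
  exact forall₄_congr fun d g x hx => L.ex_gc _ _ _

theorem extend_mono {c : P.base} {U V : P.Ideal c} (h : U ≤ V) : f.extend U ≤ f.extend V :=
  f.gc_extend_restrict.monotone_l h

theorem fibMap_le_extend {d c : P.base} {U : P.Ideal c} {g : d ⟶ c} {x : P.fib d}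
    (h : U.mem g x) : f.fibMap x ≤ L.pull (f.baseFunctor.map g) (f.extend U) :=
  f.gc_extend_restrict.le_u_l U g x h

/-- The pair `(𝟙, x)` is the largest generator of `η x`; this equality is what makes the extension
restrict to `f` along the unit on the nose. -/
theorem extend_principal {c : P.base} (x : P.fib c) :
    f.extend (principal x).closure = f.fibMap x := by
  refine le_antisymm ?_ ?_
  · refine (f.gc_extend_restrict _ _).2 (Ideal.closure_le _ _ fun d g y hy => ?_)
    exact f.fibMap_le_pull hy
  · have h : f.fibMap x ≤ L.pull (f.baseFunctor.map (𝟙 c)) (f.extend (principal x).closure) :=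
      f.fibMap_le_extend (Ideal.subset_closure _ _ _ (P.pull_id x).ge)
    rwa [f.baseFunctor.map_id, L.pull_id] at h

/-- The sieve of arrows into `(d, W)` which factor, over `k : d ⟶ F c`, through an element of
the ideal `U`. -/
def factorSieve {c : P.base} (U : P.Ideal c) {d : L.base} (k : d ⟶ f.baseFunctor.obj c)
    (W : L.fib d) : Sieve (L.mkObj d W) where
  arrows X h := ∃ (e : P.base) (g : e ⟶ c) (x : P.fib e) (l : L.pt X ⟶ f.baseFunctor.obj e),
    U.mem g x ∧ L.val X ≤ L.pull l (f.fibMap x) ∧ l ≫ f.baseFunctor.map g = L.arr h ≫ k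
  downward_closed := by
    rintro _ Y h ⟨e, g, x, l, hx, hl, hg⟩ j
    refine ⟨e, g, x, L.arr j ≫ l, hx, ?_, ?_⟩
    · rw [L.pull_comp]
      exact (L.val_le j).trans (OrderHomClass.mono _ hl)
    · rw [Category.assoc, hg]
      exact (Category.assoc _ _ _).symm

/-- For `k = 𝟙` and `W = extend U` the sieve covers by the definition of the join. The general sieve
is a pullback of that one, and pullback stability of the topology is where the relative
Beck-Chevalley condition enters. -/
theorem factorSieve_mem {c : P.base} (U : P.Ideal c) {d : L.base}
    (k : d ⟶ f.baseFunctor.obj c) (W : L.fib d) (hW : W ≤ L.pull k (f.extend U)) :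
    f.factorSieve U k W ∈ L.topology (L.mkObj d W) := by
  have h : f.factorSieve U (𝟙 _) (f.extend U) ∈ L.topology (L.mkObj _ (f.extend U)) := by
    refine GeometricDoctrine.mem_topology_iff.2 fun v hv => ?_
    refine (f.gc_extend_restrict _ _).2 fun d g x hx => ?_
    exact hv (L.mkObj _ (f.fibMap x)) (L.mkHom _ (f.fibMap_le_extend hx))
      ⟨d, g, x, 𝟙 _, hx, (L.pull_id _).ge, (Category.id_comp _).trans (Category.comp_id _).symm⟩
  convert L.topology.pullback_stable (L.mkHom k hW) h using 1
  ext X j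
  refine exists_congr fun e => exists_congr fun g => exists_congr fun x => exists_congr fun l => ?_
  refine and_congr_right fun _ => and_congr_right fun _ => ?_
  rw [Category.comp_id]
  rfl

/-- Local reasoning: an element below a pullback of `extend U` may be assumed to lie below a
pullback of the value at a single member of `U`. -/
theorem le_of_le_extend {c : P.base} {U : P.Ideal c} {d : L.base}
    {k : d ⟶ f.baseFunctor.obj c} {W v : L.fib d} (hW : W ≤ L.pull k (f.extend U))
    (h : ∀ (d' : L.base) (j : d' ⟶ d) (V : L.fib d') (e : P.base) (g : e ⟶ c) (x : P.fib e)
      (l : d' ⟶ f.baseFunctor.obj e), V ≤ L.pull j W → U.mem g x → V ≤ L.pull l (f.fibMap x) →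
      l ≫ f.baseFunctor.map g = j ≫ k → V ≤ L.pull j v) : W ≤ v := by
  refine GeometricDoctrine.le_of_covering (f.factorSieve_mem U k W hW) ?_
  rintro d' j V hV ⟨e, g, x, l, hx, hl, hg⟩
  exact h d' j V e g x l hV hx hl hg

theorem extend_pullback {d c : P.base} (g : d ⟶ c) (U : P.Ideal c) :
    f.extend (Ideal.pullback g U) = L.pull (f.baseFunctor.map g) (f.extend U) := by
  refine le_antisymm ?_ ?_
  · refine (f.gc_extend_restrict _ _).2 fun e h x hx => ?_
    have := f.fibMap_le_extend (g := h ≫ g) (x := x) hx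
    rwa [Functor.map_comp, L.pull_comp] at this
  · refine f.le_of_le_extend le_rfl fun d' j V e h x l _ hx hl hh => ?_
    -- The square lies over the image of `F`, so it comes from a square in the base; restricting `x`
    -- along `p` then gives a member of `g^* U` over `q`.
    obtain ⟨b, p, q, k, hpq, rfl, rfl⟩ := f.flat.exists_square (F := f.baseFunctor) h g l j hh
    have h1 : (Ideal.pullback g U).mem q (P.pull p x) := by
      change U.mem (q ≫ g) _
      rw [← hpq]
      exact U.down h x p _ hx le_rfl
    have h2 := f.fibMap_le_extend h1
    rw [L.pull_comp]
    rw [L.pull_comp, ← f.fibMap_pull] at hl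
    exact hl.trans (OrderHomClass.mono _ h2)

theorem extend_inf {c : P.base} (U V : P.Ideal c) :
    f.extend (U ⊓ V) = f.extend U ⊓ f.extend V := by
  refine le_antisymm (le_inf (f.extend_mono inf_le_left) (f.extend_mono inf_le_right)) ?_
  refine f.le_of_le_extend (U := U) (k := 𝟙 _) (inf_le_left.trans (L.pull_id _).ge) ?_
  intro d₁ j₁ W₁ e₁ g₁ x₁ l₁ hW₁ hx₁ hl₁ hg₁
  refine f.le_of_le_extend (U := V) (k := j₁)
    (hW₁.trans (OrderHomClass.mono _ inf_le_right)) ?_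
  intro d₂ j₂ W₂ e₂ g₂ x₂ l₂ hW₂ hx₂ hl₂ hg₂
  have hl₁' : W₂ ≤ L.pull (j₂ ≫ l₁) (f.fibMap x₁) := by
    rw [L.pull_comp]
    exact hW₂.trans (OrderHomClass.mono _ hl₁)
  -- The span is taken in the total category because the fibres of `P` need not have meets: it
  -- supplies, locally, an element lying below restrictions of both `x₁` and `x₂`.
  obtain ⟨S, hS, hS'⟩ := f.site.cover_span (c₁ := Doctrine.Total.mk e₁ x₁)
    (c₂ := Doctrine.Total.mk e₂ x₂) (d := L.mkObj d₂ W₂) (L.mkHom _ hl₁') (L.mkHom _ hl₂)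
  refine GeometricDoctrine.le_of_covering hS fun d₃ j₃ W₃ hW₃ hj₃ => ?_
  obtain ⟨Z, p₁, p₂, k', hk₁', hk₂'⟩ := hS' _ hj₃
  obtain ⟨k, hk, hk₁, hk₂⟩ : ∃ k : d₃ ⟶ f.baseFunctor.obj Z.base,
      W₃ ≤ L.pull k (f.fibMap Z.elt) ∧ k ≫ f.baseFunctor.map p₁.hom = j₃ ≫ j₂ ≫ l₁ ∧
      k ≫ f.baseFunctor.map p₂.hom = j₃ ≫ l₂ :=
    ⟨L.arr k', L.val_le k', congrArg Doctrine.Total.Hom.hom hk₁',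
      congrArg Doctrine.Total.Hom.hom hk₂'⟩
  -- The composites to `c` through `p₁` and `p₂` agree only after applying `F` and precomposing with
  -- `k`. Flatness of `F` makes them equal along `q`, so one pair belongs to both ideals.
  obtain ⟨b, q, l, hq, hl⟩ := f.flat.exists_equalizer (F := f.baseFunctor) (p₁.hom ≫ g₁)
    (p₂.hom ≫ g₂) k (by
      rw [Functor.map_comp, Functor.map_comp, reassoc_of% hk₁, reassoc_of% hk₂, hg₁, hg₂]
      simp)
  have hm : (U ⊓ V).mem (q ≫ p₁.hom ≫ g₁) (P.pull q Z.elt) := by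
    refine ⟨U.down _ _ q _ (U.down _ _ p₁.hom _ hx₁ p₁.elt_le) le_rfl, ?_⟩
    rw [hq]
    exact V.down _ _ q _ (V.down _ _ p₂.hom _ hx₂ p₂.elt_le) le_rfl
  have hm' := OrderHomClass.mono (L.pull l) (f.fibMap_le_extend hm)
  rw [f.fibMap_pull, ← L.pull_comp, ← L.pull_comp, hl] at hm'
  have hc : l ≫ f.baseFunctor.map (q ≫ p₁.hom ≫ g₁) = j₃ ≫ j₂ ≫ j₁ := by
    rw [Functor.map_comp, reassoc_of% hl, Functor.map_comp, reassoc_of% hk₁, hg₁,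
      Category.comp_id]
  rw [hc] at hm'
  simp only [L.pull_comp] at hm' ⊢
  exact hk.trans hm'

end Hom

theorem hom_mk_eq {P Q : DocSite.{v, u, w}} {F : P.base ⥤ Q.base} {a a' : P.fn ⟶ F.op ⋙ Q.fn}
    {hF : IsFlat F} {ha : IsMorphismOfSites P.top Q.top (Doctrine.totalMap F a)}
    {ha' : IsMorphismOfSites P.top Q.top (Doctrine.totalMap F a')}
    (h : ∀ (c : P.base) (x : P.fib c), Doctrine.comp a c x = Doctrine.comp a' c x) :
    Hom.mk F a hF ha = Hom.mk F a' hF ha' := by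
  obtain rfl : a = a' := by
    ext c x
    exact h c.unop x
  rfl

namespace Hom

variable (f : DocSite.Hom P L.toDocSite)

/-- Functoriality of `F` alone gives naturality of the right adjoint; it serves to transpose the
cover condition. -/
theorem pullback_restrict {d c : P.base} (g : d ⟶ c) (v : L.fib (f.baseFunctor.obj c)) :
    Ideal.pullback g (f.restrict v) = f.restrict (L.pull (f.baseFunctor.map g) v) := by
  refine Ideal.ext ?_
  funext e h x
  change (_ ≤ _) = (_ ≤ _)
  rw [Functor.map_comp, L.pull_comp]

/-- The natural transformation underlying the extension of `f` to the geometric completion. -/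
noncomputable def extendNat : P.completion.toDoctrine.fn ⟶ f.F.op ⋙ L.toDocSite.fn where
  app c := Preord.ofHom
    { toFun := fun U : P.Ideal c.unop => f.extend U
      monotone' := fun _ _ h => f.extend_mono h }
  naturality c d g := by
    ext U
    exact f.extend_pullback g.unop U

/-- Fibres of the completion have meets and `extend` preserves them, so flatness of `F` gives a
factorisation without passing to a cover. -/
theorem exists_extend_span {c₁ c₂ : P.base} {d : L.base} {W : L.fib d} (U₁ : P.Ideal c₁)
    (U₂ : P.Ideal c₂) (g₁ : d ⟶ f.baseFunctor.obj c₁) (g₂ : d ⟶ f.baseFunctor.obj c₂)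
    (h₁ : W ≤ L.pull g₁ (f.extend U₁)) (h₂ : W ≤ L.pull g₂ (f.extend U₂)) :
    ∃ (c : P.base) (p₁ : c ⟶ c₁) (p₂ : c ⟶ c₂) (k : d ⟶ f.baseFunctor.obj c),
      W ≤ L.pull k (f.extend (Ideal.pullback p₁ U₁ ⊓ Ideal.pullback p₂ U₂)) ∧
        k ≫ f.baseFunctor.map p₁ = g₁ ∧ k ≫ f.baseFunctor.map p₂ = g₂ := by
  obtain ⟨c, p₁, p₂, k, rfl, rfl⟩ := f.flat.exists_span (F := f.baseFunctor) g₁ g₂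
  refine ⟨c, p₁, p₂, k, ?_, rfl, rfl⟩
  rw [f.extend_inf, f.extend_pullback, f.extend_pullback, map_inf, ← L.pull_comp, ← L.pull_comp]
  exact le_inf h₁ h₂

theorem exists_extend_equalizer {c' c : P.base} {d : L.base} {W : L.fib d} (U : P.Ideal c')
    (f₁ f₂ : c' ⟶ c) (g : d ⟶ f.baseFunctor.obj c')
    (hg : g ≫ f.baseFunctor.map f₁ = g ≫ f.baseFunctor.map f₂)
    (h : W ≤ L.pull g (f.extend U)) :
    ∃ (b : P.base) (e : b ⟶ c') (k : d ⟶ f.baseFunctor.obj b),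
      W ≤ L.pull k (f.extend (Ideal.pullback e U)) ∧ e ≫ f₁ = e ≫ f₂ ∧
        k ≫ f.baseFunctor.map e = g := by
  obtain ⟨b, e, k, he, rfl⟩ := f.flat.exists_equalizer (F := f.baseFunctor) f₁ f₂ g hg
  refine ⟨b, e, k, ?_, he, rfl⟩
  rwa [f.extend_pullback, ← L.pull_comp]

/-- The functor on total categories underlying the extension of `f`. -/
noncomputable abbrev extendTotal : P.completion.toDocSite.Total ⥤ L.toDocSite.Total :=
  Doctrine.totalMap (P := P.completion.toDoctrine) (Q := L.toDoctrine) f.F f.extendNat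

/-- An upper bound `v` for the image sieve transposes to the upper bound `restrict v` for the
original one, which therefore dominates the covered ideal. -/
theorem extend_coverPreserving {Y : P.completion.Total} (S : Sieve Y)
    (hS : S ∈ P.completion.topology Y) :
    S.functorPushforward f.extendTotal ∈ L.topology (f.extendTotal.obj Y) := by
  refine GeometricDoctrine.mem_topology_iff.2 fun v hv => ?_
  refine (f.gc_extend_restrict _ _).2 ?_
  refine GeometricDoctrine.mem_topology_iff.1 hS _ fun X k hk => ?_
  refine le_of_le_of_eq ?_ (f.pullback_restrict (P.completion.arr k) v).symm
  refine (f.gc_extend_restrict _ _).1 ?_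
  exact hv _ (f.extendTotal.map k) (Sieve.image_mem_functorPushforward _ _ hk)

theorem extend_site :
    IsMorphismOfSites P.completion.toDocSite.top L.toDocSite.top f.extendTotal where
  cover_preserving S hS := f.extend_coverPreserving S hS
  cover_obj Y := by
    obtain ⟨S, hS, h⟩ := f.site.cover_obj Y
    refine ⟨S, hS, fun X k hk => ?_⟩
    obtain ⟨Z, ⟨l⟩⟩ := h k hk
    refine ⟨P.completion.mkObj Z.base (principal Z.elt).closure, ⟨?_⟩⟩
    exact Doctrine.Total.Hom.mk (P := L.toDoctrine) l.hom
      (l.elt_le.trans (OrderHomClass.mono (L.pull l.hom) (f.extend_principal Z.elt).ge))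
  cover_span {X₁ X₂ Y} g₁ g₂ := by
    refine ⟨⊤, L.topology.top_mem Y, fun Z h _ => ?_⟩
    obtain ⟨c, p₁, p₂, k, hU, hk₁, hk₂⟩ := f.exists_extend_span X₁.elt X₂.elt
      (L.arr (h ≫ g₁)) (L.arr (h ≫ g₂)) (L.val_le (h ≫ g₁)) (L.val_le (h ≫ g₂))
    let U : P.Ideal c := Ideal.pullback p₁ X₁.elt ⊓ Ideal.pullback p₂ X₂.elt
    exact ⟨P.completion.mkObj c U,
      P.completion.mkHom p₁ (V := X₁.elt) (inf_le_left : U ≤ Ideal.pullback p₁ X₁.elt),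
      P.completion.mkHom p₂ (V := X₂.elt) (inf_le_right : U ≤ Ideal.pullback p₂ X₂.elt),
      Doctrine.Total.Hom.mk (P := L.toDoctrine) k hU,
      Doctrine.Total.hom_ext hk₁, Doctrine.Total.hom_ext hk₂⟩
  cover_equalizer {X' X} f₁ f₂ Y g hg := by
    refine ⟨⊤, L.topology.top_mem Y, fun Z h _ => ?_⟩
    have hg' : (h ≫ g) ≫ f.extendTotal.map f₁ = (h ≫ g) ≫ f.extendTotal.map f₂ := by
      rw [Category.assoc, Category.assoc, hg]
    obtain ⟨b, e, k, hU, he, hk⟩ := f.exists_extend_equalizer X'.elt f₁.hom f₂.hom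
      (L.arr (h ≫ g)) (congrArg Doctrine.Total.Hom.hom hg') (L.val_le (h ≫ g))
    exact ⟨P.completion.mkObj b (Ideal.pullback e X'.elt),
      P.completion.mkHom e (V := X'.elt) le_rfl,
      Doctrine.Total.Hom.mk (P := L.toDoctrine) k hU,
      Doctrine.Total.hom_ext he, Doctrine.Total.hom_ext hk⟩

/-- The extension of a morphism into a geometric doctrine to the geometric completion. -/
noncomputable def extendHom : P.completion.toDocSite ⟶ L.toDocSite :=
  ⟨f.F, f.extendNat, f.flat, f.extend_site⟩

end Hom

/-! ### One- and two-dimensional universal property of the unit -/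

/-- The unit as a morphism of doctrinal sites. -/
noncomputable def unitHom (h : IsMorphismOfSites P.top P.completion.topology
    (Doctrine.totalMap (Q := P.completion.toDoctrine) (𝟭 P.base) P.unit)) :
    P ⟶ P.completion.toDocSite :=
  ⟨𝟭 P.base, P.unit, IsMorphismOfSites.id _, h⟩

theorem unitHom_extendHom (h) (f : P ⟶ L.toDocSite) : unitHom h ≫ Hom.extendHom f = f :=
  hom_mk_eq fun _ x => Hom.extend_principal f x

/-- Every ideal is the join of the `∃_g (η x)` over its members; only this half is needed, to show
that those members cover it. -/
theorem le_extend_unitHom (h) {c : P.base} (U : P.Ideal c) :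
    U ≤ (Hom.extend (unitHom h) U : P.Ideal c) := fun d g x hx => by
  have h1 : (Hom.extend (unitHom h) U : P.Ideal c).mem (𝟙 d ≫ g) x :=
    Hom.fibMap_le_extend (unitHom h) hx (𝟙 d) x
      (Ideal.subset_closure _ _ _ (P.pull_id x).ge)
  exact (congrArg (fun q => (Hom.extend (unitHom h) U : P.Ideal c).mem q x)
    (Category.id_comp g)).mp h1

/-- A morphism out of the geometric completion is the extension of its restriction along the
unit. -/
theorem extendHom_unitHom (h) (b : P.completion.toDocSite ⟶ L.toDocSite) :
    Hom.extendHom (unitHom h ≫ b) = b := by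
  refine hom_mk_eq fun c U => le_antisymm (α := L.fib ((Hom.baseFunctor b).obj c)) ?_ ?_
  -- A member `(g, x)` of `U` satisfies `η x ≤ g^* U`; apply the monotone natural map `b`.
  · refine ((Hom.gc_extend_restrict (unitHom h ≫ b)) _ _).2 fun d g x hx => ?_
    exact Hom.fibMap_le_pull (P := P.completion.toDocSite) b (c := c) (g := g)
      (y := (principal x).closure) (x := U) (Ideal.closure_le (P := P) _ (Ideal.pullback g U)
        fun e k y hy => U.down g x k y hx hy)
  -- For the converse, `(c, U)` is covered by arrows factoring through some `(d, η x)` with `(g, x)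
  -- ∈ U`, and `b` preserves this cover.
  · have hS := Hom.factorSieve_mem (unitHom h) (c := c) U (𝟙 c) U
      ((le_extend_unitHom h U).trans (P.completion.pull_id _).ge)
    refine Hom.fibMap_le_of_covering (P := P.completion.toDocSite) b hS ?_
    rintro X k ⟨d, g, x, l, hx, hl, hg⟩
    have h1 := Hom.fibMap_le_pull (P := P.completion.toDocSite) b (g := l) hl
    have h2 := OrderHomClass.mono (L.pull ((Hom.baseFunctor b).map l))
      (Hom.fibMap_le_extend (unitHom h ≫ b) hx)
    have hk : (Hom.baseFunctor b).map k.hom =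
        (Hom.baseFunctor b).map l ≫ (Hom.baseFunctor b).map g :=
      (congrArg (Hom.baseFunctor b).map (hg.trans (Category.comp_id _))).symm.trans
        ((Hom.baseFunctor b).map_comp l g)
    refine h1.trans (h2.trans (le_of_eq ?_))
    exact (L.pull_comp _ _ _).symm.trans
      (congrArg (fun q => L.pull q (Hom.extend (unitHom h ≫ b) U)) hk.symm)

/-- The extension of 2-cells to the geometric completion. -/
theorem extend_le {f f' : P ⟶ L.toDocSite} (α : f ⟶ f') {c : P.base} (U : P.Ideal c) :
    Hom.extend f U ≤ L.pull (α.nat.app c) (Hom.extend f' U) := by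
  refine (Hom.gc_extend_restrict f _ _).2 fun d g x hx => ?_
  have h1 : Hom.fibMap f x ≤ L.pull (α.nat.app d) (Hom.fibMap f' x) := α.fib_le d x
  refine h1.trans ((OrderHomClass.mono _ (Hom.fibMap_le_extend f' hx)).trans ?_)
  -- Naturality of `α` at `g` exchanges restriction along `α_d` and `F' g` for restriction along `F
  -- g` and `α_c`.
  have h2 := congrArg (fun q => L.pull q (Hom.extend f' U)) (α.nat.naturality g)
  exact ((L.pull_comp _ _ _).symm.trans (h2.symm.trans (L.pull_comp _ _ _))).le

end DocSite

/-! ### The strict 2-functor and the 2-adjunction -/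

namespace CoarseGeometricCompletion

open Bicategory

variable (A : CoarseGeometricCompletion.{v, u, w})

section

variable {A}

/-- A 1-cell of `A-Doc` into a geometric doctrine, as a morphism to its canonical site. -/
noncomputable def toCanonical {P : A.ADoc} {L : A.GeomDoc} (f : P ⟶ A.embedding.obj L) :
    P.val ⟶ L.1.toDocSite :=
  ⟨f.val.F, f.val.a, f.val.flat, f.val.site.mono_right (A.top_le L.1 L.2)⟩

theorem unit_site (P : A.ADoc) : IsMorphismOfSites P.val.top P.val.completion.topology
    (Doctrine.totalMap (Q := P.val.completion.toDoctrine) (𝟭 P.val.base) P.val.unit) :=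
  (A.unit P).val.site.mono_right (A.top_le _ _)

/-- The transpose of a 1-cell of `A-Doc` into a geometric doctrine. -/
noncomputable def lift {P : A.ADoc} {L : A.GeomDoc} (f : P ⟶ A.embedding.obj L) :
    A.completion P ⟶ L :=
  InducedBicategory.mkHom (DocSite.Hom.extendHom (toCanonical f))

/-- The transpose of a 2-cell of `A-Doc`. -/
noncomputable def lift₂ {P : A.ADoc} {L : A.GeomDoc} {f g : P ⟶ A.embedding.obj L} (α : f ⟶ g) :
    lift f ⟶ lift g :=
  InducedBicategory.Hom₂.mk (DocSite.Hom₂.mk α.val.nat fun c U =>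
    DocSite.extend_le (P := P.val) (L := L.1) (f := toCanonical f) (f' := toCanonical g)
      (DocSite.Hom₂.mk α.val.nat α.val.fib_le) (c := c) U)

/-- Enlarging the topology changes no data, only propositions; equalities of 1-cells can thus be
checked for the canonical topology. -/
theorem toCanonical_injective {P : A.ADoc} {L : A.GeomDoc} {f g : P ⟶ A.embedding.obj L}
    (h : toCanonical f = toCanonical g) : f = g := by
  obtain ⟨⟨F, a, hF, ha⟩, hf⟩ := f
  obtain ⟨⟨G, b, hG, hb⟩, hg⟩ := g
  obtain ⟨rfl, h'⟩ := DocSite.Hom.mk.inj h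
  obtain rfl := eq_of_heq h'
  rfl

theorem unit_lift {P : A.ADoc} {L : A.GeomDoc} (f : P ⟶ A.embedding.obj L) :
    A.unit P ≫ A.embedding.map (lift f) = f :=
  toCanonical_injective (DocSite.unitHom_extendHom (unit_site P) (toCanonical f))

theorem lift_unit {P : A.ADoc} {L : A.GeomDoc} (b : A.completion P ⟶ L) :
    lift (A.unit P ≫ A.embedding.map b) = b :=
  InducedBicategory.hom_ext (DocSite.extendHom_unitHom (unit_site P) b.hom)

theorem completion_hom_ext {P : A.ADoc} {L : A.GeomDoc} {b b' : A.completion P ⟶ L}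
    (h : A.unit P ≫ A.embedding.map b = A.unit P ≫ A.embedding.map b') : b = b' := by
  rw [← lift_unit b, h, lift_unit]

theorem lift_comp {P : A.ADoc} {K L : A.GeomDoc} (f : P ⟶ A.embedding.obj K) (g : K ⟶ L) :
    lift f ≫ g = lift (f ≫ A.embedding.map g) :=
  completion_hom_ext (by
    rw [unit_lift, A.embedding.map_comp, ← Strict.assoc, unit_lift])

theorem lift_comp_lift {P Q : A.ADoc} {L : A.GeomDoc} (f : P ⟶ Q) (g : Q ⟶ A.embedding.obj L) :
    lift (f ≫ A.unit Q) ≫ lift g = lift (f ≫ g) := by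
  rw [lift_comp, Strict.assoc, unit_lift]

theorem lift_comp_unit {P Q R : A.ADoc} (f : P ⟶ Q) (g : Q ⟶ R) :
    lift ((f ≫ g) ≫ A.unit R) = lift (f ≫ A.unit Q) ≫ lift (g ≫ A.unit R) := by
  rw [lift_comp_lift, Strict.assoc]

theorem lift_unit_self (P : A.ADoc) : lift (A.unit P) = 𝟙 (A.completion P) :=
  completion_hom_ext (by
    rw [unit_lift, A.embedding.map_id]
    exact (Strict.comp_id _).symm)

theorem doc_hom₂_ext {P Q : A.ADoc} {f g : P ⟶ Q} {α β : f ⟶ g}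
    (h : ∀ c, α.val.nat.app c = β.val.nat.app c) : α = β :=
  TwoFullSub.hom₂_ext (DocSite.hom₂_ext (NatTrans.ext (funext h)))

theorem geom_hom₂_ext {K L : A.GeomDoc} {f g : K ⟶ L} {α β : f ⟶ g}
    (h : ∀ c, α.hom.nat.app c = β.hom.nat.app c) : α = β :=
  InducedBicategory.hom₂_ext (DocSite.hom₂_ext (NatTrans.ext (funext h)))

/-- A 2-cell is determined by its components. Comparing them heterogeneously avoids computing
components of `eqToHom`, since the equality of 1-cells is eliminated first; the companion lemmas
below have the same purpose. -/
theorem doc_eq_eqToHom {P Q : A.ADoc} {f g : P ⟶ Q} {α : f ⟶ g} (p : f = g)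
    (h : ∀ c, HEq (α.val.nat.app c) (𝟙 (f.val.F.obj c))) : α = eqToHom p := by
  subst p
  exact doc_hom₂_ext fun c => eq_of_heq (h c)

theorem doc_comp_eqToHom_eq {P Q : A.ADoc} {f f' g g' : P ⟶ Q} {α : f ⟶ f'} {β : g ⟶ g'}
    (p : f = g) (q : f' = g') (h : ∀ c, HEq (α.val.nat.app c) (β.val.nat.app c)) :
    α ≫ eqToHom q = eqToHom p ≫ β := by
  subst p q
  rw [eqToHom_refl, Category.comp_id, eqToHom_refl, Category.id_comp]
  exact doc_hom₂_ext fun c => eq_of_heq (h c)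

theorem geom_comp_eqToHom_eq {K L : A.GeomDoc} {f f' g g' : K ⟶ L} {α : f ⟶ f'} {β : g ⟶ g'}
    (p : f = g) (q : f' = g') (h : ∀ c, HEq (α.hom.nat.app c) (β.hom.nat.app c)) :
    α ≫ eqToHom q = eqToHom p ≫ β := by
  subst p q
  rw [eqToHom_refl, Category.comp_id, eqToHom_refl, Category.id_comp]
  exact geom_hom₂_ext fun c => eq_of_heq (h c)

theorem geom_eq_eqToHom_comp {K L : A.GeomDoc} {f f' g g' : K ⟶ L} {α : f ⟶ f'} {β : g ⟶ g'}
    (p : f = g) (q : f' = g') (h : ∀ c, HEq (α.hom.nat.app c) (β.hom.nat.app c)) :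
    α = eqToHom p ≫ β ≫ eqToHom q.symm := by
  subst p q
  rw [eqToHom_refl, eqToHom_refl, Category.comp_id, Category.id_comp]
  exact geom_hom₂_ext fun c => eq_of_heq (h c)

end

/-- The 2-functor `ℨ_A`. -/
noncomputable def completionFunctor : StrictPseudofunctor A.ADoc A.GeomDoc :=
  StrictPseudofunctor.mk''
    { obj := A.completion
      map := fun {_ Q} f => lift (f ≫ A.unit Q)
      map₂ := fun {_ Q _ _} α => lift₂ (α ▷ A.unit Q)
      map₂_id := fun _ => geom_hom₂_ext fun _ => rfl
      map₂_comp := fun _ _ => geom_hom₂_ext fun _ => rfl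
      map_id := fun P => (congrArg lift (Strict.id_comp _)).trans (lift_unit_self P)
      map_comp := lift_comp_unit
      map₂_whisker_left := fun f g g' _ =>
        geom_eq_eqToHom_comp (lift_comp_unit f g) (lift_comp_unit f g') fun _ => HEq.rfl
      map₂_whisker_right := fun {_ _ _ f f'} _ g =>
        geom_eq_eqToHom_comp (lift_comp_unit f g) (lift_comp_unit f' g) fun _ => HEq.rfl }

theorem unit_completionFunctor_map {P Q : A.ADoc} (f : P ⟶ Q) :
    f ≫ A.unit Q = A.unit P ≫ A.embedding.map (A.completionFunctor.map f) :=
  (unit_lift _).symm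

/-- The counit of the 2-adjunction. -/
noncomputable def counit (L : A.GeomDoc) : A.completionFunctor.obj (A.embedding.obj L) ⟶ L :=
  lift (P := A.embedding.obj L) (𝟙 (A.embedding.obj L))

theorem unit_counit (L : A.GeomDoc) : A.unit (A.embedding.obj L) ≫ A.embedding.map (A.counit L) =
    𝟙 (A.embedding.obj L) :=
  unit_lift _

/-- The 2-adjunction between `ℨ_A` and the embedding. -/
noncomputable def adjunction : TwoAdjunction A.completionFunctor A.embedding where
  unit := A.unit
  unit_naturality := A.unit_completionFunctor_map
  unit_naturality₂ α := doc_comp_eqToHom_eq _ _ fun _ => HEq.rfl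
  counit := A.counit
  counit_naturality f := by
    -- Both sides are the transpose of the image of `f` under the embedding.
    refine (lift_comp_lift (A.embedding.map f) (𝟙 _)).trans (Eq.trans ?_ (lift_comp (𝟙 _) f).symm)
    rw [Strict.comp_id, Strict.id_comp]
  counit_naturality₂ α := geom_comp_eqToHom_eq _ _ fun _ => HEq.rfl
  left_triangle P := by
    refine (lift_comp_lift (A.unit P) (𝟙 _)).trans ?_
    rw [Strict.comp_id, lift_unit_self]
    rfl
  right_triangle := A.unit_counit

/-! ### Lax idempotency -/

/-- The image of the unit under `ℨ_A` is below the unit at the completion. -/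
theorem extend_unit_unit_le (P : A.ADoc) {c : P.val.base} (U : P.val.Ideal c) :
    DocSite.Hom.extend (toCanonical (A.unit P ≫ A.unit (A.embedding.obj (A.completion P)))) U ≤
      (DocSite.principal (P := (A.embedding.obj (A.completion P)).val) (c := c) U).closure := by
  refine (DocSite.Hom.gc_extend_restrict _ _ _).2 fun d g x hx => ?_
  refine DocSite.Ideal.closure_le _ _ fun e k V hV => ?_
  refine DocSite.Ideal.subset_closure _ _ _ ?_
  -- It suffices to treat the generators `V ≤ k^* (η x)` of `η (η x)`; since `η x ≤ g^* U`, these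
  -- satisfy `V ≤ (k ≫ g)^* U`.
  have hU : (DocSite.principal x).closure ≤ DocSite.Ideal.pullback g U :=
    DocSite.Ideal.closure_le _ _ fun e k y hy => U.down g x k y hx hy
  refine (hV.trans (OrderHomClass.mono (P.val.completion.pull k) hU)).trans ?_
  exact (P.val.completion.pull_comp k g U).ge

/-- The 2-cell from the image of the unit under `ℨ_A` to the unit at the completion. -/
noncomputable def laxCell (P : A.ADoc) :
    A.embedding.map (lift (A.unit P ≫ A.unit (A.embedding.obj (A.completion P)))) ⟶
      A.unit (A.embedding.obj (A.completion P)) :=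
  TwoFullSub.Hom₂.mk (DocSite.Hom₂.mk (𝟙 (𝟭 P.val.base)) fun c U =>
    (A.extend_unit_unit_le P U).trans
      ((A.embedding.obj (A.completion P)).val.completion.pull_id (c := c) _).ge)

/-- Right whiskering applies the base functor to an identity arrow, so `map_id` is needed, whereas
left whiskering evaluates to an identity definitionally. -/
theorem laxCell_whiskerRight_app {P Q : A.ADoc}
    (f : A.embedding.obj (A.completion (A.embedding.obj (A.completion P))) ⟶ Q) (c : P.val.base) :
    (A.laxCell P ▷ f).val.nat.app c = 𝟙 (f.val.F.obj c) :=
  f.val.F.map_id c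

/-- Both whiskerings have identity components, so only the agreement of base functors matters; for
`T f` and `T (T f)` it is definitional. -/
theorem laxCell_naturality {P Q : A.ADoc}
    (f : A.embedding.obj (A.completion P) ⟶ A.embedding.obj (A.completion Q))
    (g : A.embedding.obj (A.completion (A.embedding.obj (A.completion P))) ⟶
      A.embedding.obj (A.completion (A.embedding.obj (A.completion Q))))
    (hF : f.val.F = g.val.F) (p) (q) :
    f ◁ A.laxCell Q ≫ eqToHom q = eqToHom p ≫ A.laxCell P ▷ g :=
  doc_comp_eqToHom_eq p q fun c =>
    (congr_arg_heq (fun F : P.val.base ⥤ Q.val.base => 𝟙 (F.obj c)) hF).trans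
      (heq_of_eq (A.laxCell_whiskerRight_app g c).symm)

theorem whiskerLeft_laxCell {P Q : A.ADoc} (f : P ⟶ A.embedding.obj (A.completion Q)) (p) :
    f ◁ A.laxCell Q = eqToHom p :=
  doc_eq_eqToHom p fun _ => HEq.rfl

theorem laxCell_whiskerRight {P Q : A.ADoc}
    (f : A.embedding.obj (A.completion (A.embedding.obj (A.completion P))) ⟶ Q) (p) :
    A.laxCell P ▷ f = eqToHom p :=
  doc_eq_eqToHom p fun c => heq_of_eq (A.laxCell_whiskerRight_app f c)

theorem isLaxIdempotent_monad : A.adjunction.monad.IsLaxIdempotent :=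
  ⟨A.laxCell, fun f => A.laxCell_naturality (A.embedding.map (A.completionFunctor.map f))
      (A.embedding.map (A.completionFunctor.map
        (A.embedding.map (A.completionFunctor.map f)))) rfl _ _,
    fun P => A.whiskerLeft_laxCell (A.unit P) _,
    fun P => A.laxCell_whiskerRight (A.embedding.map (A.counit (A.completion P))) _⟩

end CoarseGeometricCompletion

end CoarseGeom

theorem corollary6p5 (A : CoarseGeom.CoarseGeometricCompletion.{v, u, w}) :
    ∃ (Z : StrictPseudofunctor A.ADoc A.GeomDoc)
      (adj : CoarseGeom.TwoAdjunction Z A.embedding),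
      (∀ P : A.ADoc, Z.obj P = A.completion P) ∧
      (∀ P : A.ADoc, HEq (adj.unit P) (A.unit P)) ∧
      adj.monad.IsLaxIdempotent := by
  exact ⟨A.completionFunctor, A.adjunction, fun _ => rfl, fun _ => HEq.rfl,
    A.isLaxIdempotent_monad⟩
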